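/- Let $p$ be an odd prime, $m\ge 1$, $q=p^m$, let $\mathrm{Tr}$ be the trace from $\mathrm{GF}(q)$ to $\mathrm{GF}(p)$, let $\bar\eta$ be the quadratic character of $\mathrm{GF}(p)$ (with $\bar\eta(0)=0$), and put $p^*=(-1)^{(p-1)/2}p$. Let $a_0,\dots,a_{m-1}\in\mathrm{GF}(q)$, $a_m:=a_0$, and $$f(x)=\sum_{i=0}^{m-1}\mathrm{Tr}(a_ix^{p^i+1}),\qquad L_f(x)=\tfrac12\sum_{i=0}^{m-1}\bigl(a_i+a_{m-i}^{p^i}\bigr)x^{p^i}.$$ Let $v_0,\dots,v_{m-1}$ be a basis of $\mathrm{GF}(q)$ over $\mathrm{GF}(p)$ and let $H=(h_{jk})$ be the matrix of the quadratic form $f$ in it, $h_{jk}=\frac12\sum_i\mathrm{Tr}(a_i(v_j^{p^i}v_k+v_jv_k^{p^i}))$. Let $r=r_f$ be the rank of $H$, and let $\varepsilon=\varepsilon_f=\bar\eta((-1)^{r}\Delta)$ be the sign of $f$, where $\Delta$ is the product of the $r$ nonzero diagonal entries of a diagonal matrix $MHM^{T}$ with $M$ invertible. Let $\alpha\in\mathrm{GF}(q)$,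 $\alpha\neq0$, lie in the image of $L_f$, and let $x_\alpha\in\mathrm{GF}(q)$ satisfy $L_f(x_\alpha)=-\alpha/2$. Let $D=\{x\in\mathrm{GF}(q): x\ne0,\ f(x)-\mathrm{Tr}(\alpha x)=0\}=\{d_1,\dots,d_n\}$ with $n=\#D$, and let $$\mathcal C_D=\{(\mathrm{Tr}(xd_1),\dots,\mathrm{Tr}(xd_n)):x\in\mathrm{GF}(q)\}\subseteq\mathrm{GF}(p)^n .$$ Write $e=\varepsilon (p^*)^{-r/2}$ if $r$ is even, $e=\varepsilon\,\bar\eta(-f(x_\alpha))(p^*)^{-(r-1)/2}$ if $r$ is odd and $f(x_\alpha)\ne0$, and $e=\varepsilon(p^*)^{-(r-1)/2}$ if $r$ is odd and $f(x_\alpha)=0$. (1) The length of $\mathcal C_D$ is $n=p^{m-1}(1-e)-1$ if $r$ is even and $f(x_\alpha)\neq0$; $n=p^{m-1}(1+(p-1)e)-1$ if $r$ is even and $f(x_\alpha)=0$; $n=p^{m-1}(1+e)-1$ if $r$ is odd and $f(x_\alpha)\ne0$; $n=p^{m-1}-1$ if $r$ is odd and $f(x_\alpha)=0$. (2) Except in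 the case where $p=3$, $r=2$, $\varepsilon=-1$ and $f(x_\alpha)\neq0$, the code $\mathcal C_D$ has dimension $m$ over $\mathrm{GF}(p)$, and its weight distribution is as follows: the zero word is the only word of weight $0$, the number of codewords of each listed weight is the listed multiplicity, and no other weights occur. $r$ even, $f(x_\alpha)\ne0$: $$\begin{array}{|c|c|}\hline (p-1)p^{m-2} & p^{r-2}+\frac{p-1}{2}p^{r-1}(1-pe)-1\\ p^{m-2}(p-1-pe) & (p-1)p^{r-2}(2+pe)\\ p^{m-2}(p-1-2pe) & \frac{(p-1)(p-2)}{2}p^{r-2}(1+pe)\\ p^{m-2}(p-1)(1-e) & p^m-p^r\\ \hline\end{array}$$ $r$ even, $f(x_\alpha)=0$: $$\begin{array}{|c|c|}\hline (p-1)p^{m-2} & p^{r-2}(1+(p-1)pe)-1\\ (p-1)p^{m-2}(1+pe) & (p-1)p^{r-2}(2-pe)\\ p^{m-2}(p-1+(p-2)pe) & (p-1)^2p^{r-2}\\ p^{m-2}(p-1)(1+(p-1)e) & p^m-p^r\\ \hline\end{array}$$ $r$ odd, $f(x_\alpha)\neq0$: $$\begin{array}{|c|c|}\hline (p-1)p^{m-2}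 & p^{r-2}(1+(p-1)e)-1\\ p^{m-2}(p-1+pe) & (p-1)p^{r-2}(1-e)\\ p^{m-2}(p-1+e) & (p-1)p^{r-2}(1+(p-1)e)\\ p^{m-2}(p-1+(p+1)e) & \frac{(p-1)(p-2)}{2}p^{r-2}(1-e)\\ p^{m-2}(p-1)(1+e) & \frac{p-1}{2}p^{r-1}(1-e)+p^m-p^r\\ \hline\end{array}$$ $r$ odd, $f(x_\alpha)=0$: $$\begin{array}{|c|c|}\hline p^{m-2}(p-1)(1-e) & \frac{p-1}{2}p^{r-2}(1+pe)\\ p^{m-2}(p-1)(1+e) & \frac{p-1}{2}p^{r-2}(1-pe)\\ p^{m-2}(p-1+e) & \frac{(p-1)^2}{2}p^{r-2}\\ p^{m-2}(p-1-e) & \frac{(p-1)^2}{2}p^{r-2}\\ p^{m-2}(p-1) & p^{r-1}+p^m-p^r-1\\ \hline\end{array}$$ (A listed weight whose multiplicity is $0$ does not occur.) -/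

import Mathlib

noncomputable section

namespace QuadCode

open Matrix

variable {p : ℕ} [Fact p.Prime] {K : Type*} [Field K] [Algebra (ZMod p) K] {m : ℕ}

/-- The trace function `Tr` from `GF(p^m) = K` to `GF(p)`. -/
def Tr (x : K) : ZMod p := Algebra.trace (ZMod p) K x

/-- The homogeneous quadratic function `f(x) = ∑_{i=0}^{m-1} Tr(a_i x^{p^i+1})`. -/
def quadFun (a : Fin m → K) (x : K) : ZMod p :=
  ∑ i : Fin m, Tr (p := p) (a i * x ^ (p ^ (i : ℕ) + 1))

variable (p) in
/-- The linearized polynomial `L_f(x) = (1/2) ∑_{i=0}^{m-1} (a_i + a_{m-i}^{p^i}) x^{p^i}` of `f`.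
The indices of the coefficients are taken modulo `m`, that is, `a_m = a_0`
(in `Fin m`, `-i` is `(m - i) % m`). -/
def linPoly (a : Fin m → K) (x : K) : K :=
  2⁻¹ * ∑ i : Fin m, (a i + a (-i) ^ p ^ (i : ℕ)) * x ^ p ^ (i : ℕ)

/-- The symmetric matrix `H` of `f` in the basis `v` of `GF(p^m)` over `GF(p)`:
`h_{jk} = (1/2) ∑_i Tr(a_i (v_j^{p^i} v_k + v_j v_k^{p^i}))`. -/
def quadMatrix (a : Fin m → K) (v : Module.Basis (Fin m) (ZMod p) K) :
    Matrix (Fin m) (Fin m) (ZMod p) :=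
  Matrix.of fun j k => 2⁻¹ * ∑ i : Fin m,
    Tr (p := p) (a i * (v j ^ p ^ (i : ℕ) * v k + v j * v k ^ p ^ (i : ℕ)))

/-- `ε` is the sign of the quadratic form with symmetric matrix `H`: if `M H Mᵀ` is diagonal with
`M` invertible, `r` is the rank of `H` and `Δ` is the product of the `r` nonzero diagonal entries,
then the sign is the quadratic character of `(-1)^r Δ`. -/
def IsSign (H : Matrix (Fin m) (Fin m) (ZMod p)) (ε : ℤ) : Prop :=
  ∃ (M : GL (Fin m) (ZMod p)) (l : Fin m → ZMod p),
    (M : Matrix (Fin m) (Fin m) (ZMod p)) * H * (M : Matrix (Fin m) (Fin m) (ZMod p))ᵀ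
      = Matrix.diagonal l ∧
    ε = quadraticChar (ZMod p) ((-1) ^ H.rank * ∏ i with l i ≠ 0, l i)

/-- The defining set `D = {x ≠ 0 : f(x) - Tr(α x) = 0}`. -/
def definingSet (a : Fin m → K) (α : K) : Set K :=
  {x | x ≠ 0 ∧ quadFun (p := p) a x - Tr (p := p) (α * x) = 0}

/-- The linear code `{(Tr(x d_1), …, Tr(x d_n)) : x ∈ GF(p^m)}` over `GF(p)`. -/
def traceCode {n : ℕ} (d : Fin n → K) : Submodule (ZMod p) (Fin n → ZMod p) :=
  LinearMap.range (LinearMap.pi fun i =>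
    (Algebra.trace (ZMod p) K).comp (LinearMap.mulRight (ZMod p) (d i)))

theorem mem_traceCode {n : ℕ} (d : Fin n → K) (c : Fin n → ZMod p) :
    c ∈ traceCode d ↔ ∃ x : K, c = fun i => Tr (p := p) (x * d i) := by
  simp only [traceCode, LinearMap.mem_range]
  exact ⟨fun ⟨x, hx⟩ => ⟨x, hx.symm⟩, fun ⟨x, hx⟩ => ⟨x, hx.symm⟩⟩

/-- The code `C` has the weight distribution listed in the table `T` of pairs
(weight, multiplicity): for every row `(w, A)` exactly `A` codewords of `C` have Hamming
weight `w`, and the weight of every codeword occurs in the table. -/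
def HasWeightDistribution {n : ℕ} (C : Submodule (ZMod p) (Fin n → ZMod p))
    (T : List (ℚ × ℚ)) : Prop :=
  (∀ t ∈ T, (({c | c ∈ C ∧ (hammingNorm c : ℚ) = t.1} : Set (Fin n → ZMod p)).ncard : ℚ) = t.2) ∧
    ∀ c ∈ C, ∃ t ∈ T, (hammingNorm c : ℚ) = t.1

/-- `p* = (-1)^{(p-1)/2} p`. -/
def pStar (p : ℕ) : ℚ := (-1) ^ ((p - 1) / 2) * p

/-- Weights and multiplicities when `r` is even and `f(x_α) ≠ 0`; here `e = ε (p*)^{-r/2}`. -/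
def tableEvenNe (p : ℚ) (m r : ℤ) (e : ℚ) : List (ℚ × ℚ) :=
  [(0, 1),
   ((p - 1) * p ^ (m - 2),
      p ^ (r - 2) + (p - 1) / 2 * p ^ (r - 1) * (1 - e * p) - 1),
   (p ^ (m - 2) * (p - 1 - e * p), (p - 1) * p ^ (r - 2) * (2 + e * p)),
   (p ^ (m - 2) * (p - 1 - 2 * e * p), (p - 1) * (p - 2) / 2 * p ^ (r - 2) * (1 + e * p)),
   (p ^ (m - 2) * (p - 1) * (1 - e), p ^ m - p ^ r)]

/-- Weights and multiplicities when `r` is even and `f(x_α) = 0`; here `e = ε (p*)^{-r/2}`. -/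
def tableEvenEq (p : ℚ) (m r : ℤ) (e : ℚ) : List (ℚ × ℚ) :=
  [(0, 1),
   ((p - 1) * p ^ (m - 2), p ^ (r - 2) * (1 + e * (p - 1) * p) - 1),
   ((p - 1) * p ^ (m - 2) * (1 + e * p), (p - 1) * p ^ (r - 2) * (2 - e * p)),
   (p ^ (m - 2) * (p - 1 + e * (p - 2) * p), (p - 1) ^ 2 * p ^ (r - 2)),
   (p ^ (m - 2) * (p - 1) * (1 + e * (p - 1)), p ^ m - p ^ r)]

/-- Weights and multiplicities when `r` is odd and `f(x_α) ≠ 0`; here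
`e = ε η(-f(x_α)) (p*)^{-(r-1)/2}` with `η` the quadratic character of `GF(p)`. -/
def tableOddNe (p : ℚ) (m r : ℤ) (e : ℚ) : List (ℚ × ℚ) :=
  [(0, 1),
   ((p - 1) * p ^ (m - 2), p ^ (r - 2) * (1 + e * (p - 1)) - 1),
   (p ^ (m - 2) * (p - 1 + e * p), (p - 1) * p ^ (r - 2) * (1 - e)),
   (p ^ (m - 2) * (p - 1 + e), (p - 1) * p ^ (r - 2) * (1 + e * (p - 1))),
   (p ^ (m - 2) * (p - 1 + e * (p + 1)), (p - 1) * (p - 2) / 2 * p ^ (r - 2) * (1 - e)),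
   (p ^ (m - 2) * (p - 1) * (1 + e), (p - 1) / 2 * p ^ (r - 1) * (1 - e) + p ^ m - p ^ r)]

/-- Weights and multiplicities when `r` is odd and `f(x_α) = 0`; here
`e = ε (p*)^{-(r-1)/2}`. -/
def tableOddEq (p : ℚ) (m r : ℤ) (e : ℚ) : List (ℚ × ℚ) :=
  [(0, 1),
   (p ^ (m - 2) * (p - 1 - e * (p - 1)), (p - 1) / 2 * p ^ (r - 2) * (1 + e * p)),
   (p ^ (m - 2) * (p - 1 + e * (p - 1)), (p - 1) / 2 * p ^ (r - 2) * (1 - e * p)),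
   (p ^ (m - 2) * (p - 1 + e), (p - 1) ^ 2 / 2 * p ^ (r - 2)),
   (p ^ (m - 2) * (p - 1 - e), (p - 1) ^ 2 / 2 * p ^ (r - 2)),
   (p ^ (m - 2) * (p - 1), p ^ (r - 1) + p ^ m - p ^ r - 1)]

end QuadCode

end

/-! Let `B` be the polar form of `f`. Moving Frobenius powers across the trace gives Tr(x L_f(z)) =
B(x, z), so Tr(αx) = -2B(x, x_α) and f(x) - Tr(αx) = f(x + x_α) - f(x_α). Translation by x_α
therefore carries D onto the quadric f = f(x_α) with the point x_α removed. The weight of the word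
of b is the number of points z of this quadric with Tr(bz) ≠ Tr(b x_α): the size of the quadric
minus that of a hyperplane section through x_α.

In coordinates diagonalizing f as ∑ l_i z_i², both sizes are found by detecting equations with
additive characters and completing squares; the sums collapse to powers of the quadratic Gauss sum,
whose square is p*. If the functional b does not vanish on the radical, the section is exactly 1/p
of the quadric. Otherwise its size depends only on y = f(x_α), on c = b·u with u the coordinates of
x_α, and on the value s = ∑ b_i²/l_i of the dual form (`card_section_even`, `card_section_odd`).

The multiplicities need no second computation. The b with given s and c form a hyperplane section of
the dual quadric, which has the same rank and sign, and the dual-form value of that hyperplane is y.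
So the same formula applies with s and y exchanged (`card_image_fiber_even`,
`card_image_fiber_odd`). Each table is then a finite sum over pairs (s, c), grouped by the value of
the normalized deviation.

No nonzero b has weight 0 except when p - 1 - 2pe = 0 in the case r even, y ≠ 0. Since |pe| ≤ 1
there, this forces p = 3, r = 2, ε = -1. Outside that case evaluation is injective, so the dimension
is m and counting words is counting b. -/

noncomputable section

/-! ### Quadratic Gauss sums over GF(p) and exponential sums of diagonal forms -/

namespace QuadCode

open Finset

/-- The standard additive character of `GF(p)`, with complex values. -/
def stdChar (p : ℕ) [Fact p.Prime] : AddChar (ZMod p) ℂ := ZMod.stdAddChar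

/-- The quadratic character of `GF(p)`, with complex values. -/
def legendreChar (p : ℕ) [Fact p.Prime] : MulChar (ZMod p) ℂ :=
  (quadraticChar (ZMod p)).ringHomComp (Int.castRingHom ℂ)

/-- The quadratic Gauss sum of `GF(p)`. -/
def quadGauss (p : ℕ) [Fact p.Prime] : ℂ := gaussSum (legendreChar p) (stdChar p)

variable {p : ℕ} [Fact p.Prime]

theorem legendreChar_apply (x : ZMod p) :
    legendreChar p x = ((quadraticChar (ZMod p) x : ℤ) : ℂ) := rfl

theorem ringChar_zmod_ne_two (hp : p ≠ 2) : ringChar (ZMod p) ≠ 2 := by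
  rwa [ZMod.ringChar_zmod_n]

theorem two_ne_zero_zmod (hp : p ≠ 2) : (2 : ZMod p) ≠ 0 :=
  Ring.two_ne_zero (ringChar_zmod_ne_two hp)

theorem four_ne_zero_zmod (hp : p ≠ 2) : (4 : ZMod p) ≠ 0 := by
  have h := two_ne_zero_zmod hp
  have : (4 : ZMod p) = 2 * 2 := by norm_num
  rw [this]; exact mul_ne_zero h h

theorem stdChar_isPrimitive : (stdChar p).IsPrimitive := ZMod.isPrimitive_stdAddChar p

theorem sum_stdChar_mul (b : ZMod p) :
    ∑ x, stdChar p (b * x) = if b = 0 then (p : ℂ) else 0 := by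
  simp_rw [mul_comm b]
  rw [AddChar.sum_mulShift b stdChar_isPrimitive]
  split_ifs <;> simp [ZMod.card]

theorem sum_stdChar_mul_ne_zero (b : ZMod p) :
    ∑ x with x ≠ 0, stdChar p (b * x) = (if b = 0 then (p : ℂ) else 0) - 1 := by
  rw [← sum_stdChar_mul, ← Finset.sum_filter_add_sum_filter_not univ (fun x : ZMod p => x ≠ 0)]
  simp [Finset.filter_eq']

theorem legendreChar_ne_one (hp : p ≠ 2) : legendreChar p ≠ 1 := by
  intro h
  obtain ⟨a, ha⟩ := quadraticChar_exists_neg_one (ringChar_zmod_ne_two hp)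
  have h1 : legendreChar p a = -1 := by rw [legendreChar_apply, ha]; simp
  have ha0 : a ≠ 0 := by rintro rfl; simp at ha
  rw [h, MulChar.one_apply ha0.isUnit] at h1
  norm_num at h1

theorem quadGauss_sq (hp : p ≠ 2) : quadGauss p ^ 2 = legendreChar p (-1) * p := by
  have h := gaussSum_sq (legendreChar_ne_one hp)
    ((quadraticChar_isQuadratic (ZMod p)).comp _) (stdChar_isPrimitive (p := p))
  rw [ZMod.card] at h
  exact h

theorem legendreChar_sq {a : ZMod p} (ha : a ≠ 0) : legendreChar p a ^ 2 = 1 := by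
  rw [legendreChar_apply]; exact_mod_cast quadraticChar_sq_one ha

theorem legendreChar_inv (a : ZMod p) : legendreChar p a⁻¹ = legendreChar p a := by
  rcases eq_or_ne a 0 with rfl | ha
  · simp
  have h : legendreChar p (a⁻¹ * a ^ 2) = legendreChar p a := by congr 1; field_simp
  rwa [map_mul, map_pow, legendreChar_sq ha, mul_one] at h

theorem sum_legendreChar_mul_stdChar (hp : p ≠ 2) (a : ZMod p) :
    ∑ x, legendreChar p x * stdChar p (a * x) = legendreChar p a * quadGauss p := by
  rcases eq_or_ne a 0 with rfl | ha
  · simp only [zero_mul, AddChar.map_zero_eq_one, mul_one]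
    rw [MulChar.sum_eq_zero_of_ne_one (legendreChar_ne_one hp), MulChar.map_zero, zero_mul]
  have h := gaussSum_mulShift (legendreChar p) (stdChar p) (Units.mk0 a ha)
  simp only [gaussSum, Units.val_mk0, AddChar.mulShift_apply] at h
  rw [quadGauss, gaussSum, ← h, ← mul_assoc, ← pow_two, legendreChar_sq ha, one_mul]

theorem sum_legendreChar_mul_stdChar_ne_zero (hp : p ≠ 2) (a : ZMod p) :
    ∑ x with x ≠ 0, legendreChar p x * stdChar p (a * x) = legendreChar p a * quadGauss p := by
  rw [← sum_legendreChar_mul_stdChar hp,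
    ← Finset.sum_filter_add_sum_filter_not univ (fun x : ZMod p => x ≠ 0)]
  simp [Finset.filter_eq', MulChar.map_zero]

/-- Group the x by their square s: there are 1 + η(s) square roots, and the constant 1 contributes a
full additive character sum, which vanishes as a ≠ 0. -/
theorem sum_stdChar_sq (hp : p ≠ 2) {a : ZMod p} (ha : a ≠ 0) :
    ∑ x, stdChar p (a * x ^ 2) = legendreChar p a * quadGauss p := by
  have h1 : ∑ x, stdChar p (a * x ^ 2)
      = ∑ s, ∑ x with x ^ 2 = s, stdChar p (a * s) := by
    rw [← Finset.sum_fiberwise univ (fun x : ZMod p => x ^ 2)]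
    refine Finset.sum_congr rfl fun s _ => Finset.sum_congr rfl fun x hx => ?_
    rw [(Finset.mem_filter.1 hx).2]
  have h2 : ∀ s : ZMod p, ((#{x : ZMod p | x ^ 2 = s} : ℕ) : ℂ) = legendreChar p s + 1 := by
    intro s
    have := quadraticChar_card_sqrts (ringChar_zmod_ne_two hp) s
    rw [legendreChar_apply]
    have h3 : {x : ZMod p | x ^ 2 = s}.toFinset = ({x : ZMod p | x ^ 2 = s} : Finset (ZMod p)) := by
      ext; simp
    rw [h3] at this
    exact_mod_cast this
  rw [h1]
  simp only [Finset.sum_const, nsmul_eq_mul, h2, add_mul, one_mul, Finset.sum_add_distrib]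
  rw [sum_legendreChar_mul_stdChar hp, sum_stdChar_mul, if_neg ha, add_zero]

theorem sum_stdChar_quadratic (hp : p ≠ 2) {a : ZMod p} (ha : a ≠ 0) (b : ZMod p) :
    ∑ x, stdChar p (a * x ^ 2 + b * x)
      = legendreChar p a * quadGauss p * stdChar p (-(b ^ 2 / (4 * a))) := by
  have h2 := two_ne_zero_zmod hp
  have h4 := four_ne_zero_zmod hp
  rw [← sum_stdChar_sq hp ha, Finset.sum_mul,
    ← Equiv.sum_comp (Equiv.addRight (b / (2 * a))) (fun x => stdChar p (a * x ^ 2) * _)]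
  refine Finset.sum_congr rfl fun x _ => ?_
  rw [← AddChar.map_add_eq_mul]
  congr 1
  simp only [Equiv.coe_addRight]
  field_simp
  ring

section Diagonal

variable {ι : Type*} [Fintype ι] [DecidableEq ι]

theorem stdChar_sum (f : ι → ZMod p) : stdChar p (∑ i, f i) = ∏ i, stdChar p (f i) := by
  classical
  induction (univ : Finset ι) using Finset.induction_on with
  | empty => simp
  | insert a s ha ih => rw [Finset.sum_insert ha, Finset.prod_insert ha, AddChar.map_add_eq_mul, ih]

/-- The sum factors over the coordinates. A coordinate with l_i = 0 carries a linear sum, equal to p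
or 0 according to whether b_i vanishes; the others are Gauss sums whose phases add up to the dual
form at b. -/
theorem sum_stdChar_diagonal (hp : p ≠ 2) (l b : ι → ZMod p) {t : ZMod p} (ht : t ≠ 0) :
    ∑ z : ι → ZMod p, stdChar p (t * ∑ i, l i * z i ^ 2 + ∑ i, b i * z i)
      = if ∀ i, l i = 0 → b i = 0 then
          (p : ℂ) ^ #{i | l i = 0} * legendreChar p (∏ i with l i ≠ 0, l i)
            * quadGauss p ^ #{i | l i ≠ 0} * legendreChar p t ^ #{i | l i ≠ 0}
            * stdChar p (-((4 * t)⁻¹ * ∑ i, (l i)⁻¹ * b i ^ 2))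
        else 0 := by
  have h4 := four_ne_zero_zmod hp
  have h1 : ∑ z : ι → ZMod p, stdChar p (t * ∑ i, l i * z i ^ 2 + ∑ i, b i * z i)
      = ∏ i, ∑ x, stdChar p (t * l i * x ^ 2 + b i * x) := by
    rw [Fintype.prod_sum]
    refine Finset.sum_congr rfl fun z _ => ?_
    rw [← stdChar_sum, Finset.mul_sum, ← Finset.sum_add_distrib]
    simp only [mul_assoc]
  rw [h1]
  split_ifs with h
  · have h2 : ∀ i, ∑ x, stdChar p (t * l i * x ^ 2 + b i * x)
        = (if l i = 0 then (p : ℂ) else legendreChar p (l i) * (quadGauss p * legendreChar p t))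
          * stdChar p (-((4 * t)⁻¹ * ((l i)⁻¹ * b i ^ 2))) := by
      intro i
      split_ifs with hi
      · simp [hi, h i hi, ZMod.card]
      · rw [sum_stdChar_quadratic hp (mul_ne_zero ht hi), map_mul]
        have : b i ^ 2 / (4 * (t * l i)) = (4 * t)⁻¹ * ((l i)⁻¹ * b i ^ 2) := by
          field_simp
        rw [this]
        ring
    simp_rw [h2]
    rw [Finset.prod_mul_distrib, ← stdChar_sum, Finset.prod_ite, Finset.prod_const,
      Finset.prod_mul_distrib, Finset.prod_const, Finset.sum_neg_distrib, ← Finset.mul_sum,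
      map_prod, mul_pow]
    ring
  · push Not at h
    obtain ⟨i, hi, hb⟩ := h
    refine Finset.prod_eq_zero (Finset.mem_univ i) ?_
    simp only [hi, mul_zero, zero_mul, zero_add]
    rw [sum_stdChar_mul, if_neg hb]

theorem sum_stdChar_linear (b : ι → ZMod p) :
    ∑ z : ι → ZMod p, stdChar p (∑ i, b i * z i)
      = if b = 0 then (p : ℂ) ^ Fintype.card ι else 0 := by
  have h1 : ∑ z : ι → ZMod p, stdChar p (∑ i, b i * z i)
      = ∏ i, ∑ x, stdChar p (b i * x) := by
    rw [Fintype.prod_sum]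
    exact Finset.sum_congr rfl fun z _ => stdChar_sum _
  rw [h1]
  simp_rw [sum_stdChar_mul]
  split_ifs with h
  · simp [h]
  · obtain ⟨i, hi⟩ := Function.ne_iff.1 h
    exact Finset.prod_eq_zero (Finset.mem_univ i) (if_neg hi)

theorem indicator_eq_sum_stdChar (a : ZMod p) :
    (if a = 0 then (p : ℂ) else 0) = ∑ t, stdChar p (t * a) := by
  rw [← sum_stdChar_mul]; simp_rw [mul_comm a]

end Diagonal

end QuadCode

/-! ### Points on diagonal quadrics and on their hyperplane sections -/

namespace QuadCode

open Finset

variable {p : ℕ} [Fact p.Prime] {ι : Type*} [Fintype ι] [DecidableEq ι]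

/-- The sum of the values of `stdChar` at the diagonal quadratic form with coefficients `l`. -/
def diagGauss (l : ι → ZMod p) : ℂ :=
  (p : ℂ) ^ #{i | l i = 0} * legendreChar p (∏ i with l i ≠ 0, l i)
    * quadGauss p ^ #{i | l i ≠ 0}

/-- This is the sum over the frequency x of the hyperplane equation, with s the dual form at b. For
s ≠ 0 it is again a quadratic Gauss sum, with leading coefficient -s/(4t); the quadratic character
ignores the square 4 and the inversion of t. -/
theorem sum_stdChar_section (hp : p ≠ 2) (s c : ZMod p) {t : ZMod p} (ht : t ≠ 0) :
    ∑ x, stdChar p (-(x * c) - (4 * t)⁻¹ * (s * x ^ 2))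
      = if s = 0 then (if c = 0 then (p : ℂ) else 0)
        else legendreChar p (-s) * legendreChar p t * quadGauss p * stdChar p (c ^ 2 / s * t) := by
  have h4 := four_ne_zero_zmod hp
  split_ifs with hs hc
  · simp [hs, hc, ZMod.card]
  · simp_rw [hs, zero_mul, mul_zero, sub_zero, ← mul_neg, mul_comm _ (-c)]
    rw [sum_stdChar_mul, if_neg (neg_ne_zero.2 hc)]
  · have h0 : -((4 * t)⁻¹ * s) ≠ 0 :=
      neg_ne_zero.2 (mul_ne_zero (inv_ne_zero (mul_ne_zero h4 ht)) hs)
    have h1 : ∀ x : ZMod p, -(x * c) - (4 * t)⁻¹ * (s * x ^ 2)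
        = -((4 * t)⁻¹ * s) * x ^ 2 + (-c) * x := fun x => by ring
    simp_rw [h1]
    rw [sum_stdChar_quadratic hp h0]
    have h2 : -((-c) ^ 2 / (4 * -((4 * t)⁻¹ * s))) = c ^ 2 / s * t := by
      field_simp
    have h3 : legendreChar p (-((4 * t)⁻¹ * s)) = legendreChar p (-s) * legendreChar p t := by
      have : legendreChar p 4 = 1 := by
        rw [show (4 : ZMod p) = 2 ^ 2 by norm_num, map_pow,
          legendreChar_sq (two_ne_zero_zmod hp)]
      rw [← mul_neg, map_mul, legendreChar_inv, map_mul, this]; ring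
    rw [h2, h3]

/-- The equation is detected by averaging over frequencies t; t = 0 gives the main term, and every t
≠ 0 gives the Gauss sum of the form scaled by t. -/
theorem card_quadric (hp : p ≠ 2) (l : ι → ZMod p) (y : ZMod p) :
    (p : ℂ) * #{z : ι → ZMod p | ∑ i, l i * z i ^ 2 = y}
      = (p : ℂ) ^ Fintype.card ι + diagGauss l *
        ∑ t with t ≠ 0, legendreChar p t ^ #{i | l i ≠ 0} * stdChar p (-y * t) := by
  have h1 : (p : ℂ) * #{z : ι → ZMod p | ∑ i, l i * z i ^ 2 = y}
      = ∑ t, stdChar p (-y * t) * ∑ z : ι → ZMod p,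
          stdChar p (t * ∑ i, l i * z i ^ 2 + ∑ i, (0 : ι → ZMod p) i * z i) := by
    simp_rw [Finset.card_filter, Nat.cast_sum, Finset.mul_sum]
    rw [Finset.sum_comm]
    refine Finset.sum_congr rfl fun z _ => ?_
    have := indicator_eq_sum_stdChar (∑ i, l i * z i ^ 2 - y)
    simp only [sub_eq_zero] at this
    push_cast
    rw [mul_ite, mul_one, mul_zero, this]
    refine Finset.sum_congr rfl fun t _ => ?_
    rw [← AddChar.map_add_eq_mul]
    congr 1
    simp only [Pi.zero_apply, zero_mul, Finset.sum_const_zero, ← Finset.mul_sum]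
    generalize ∑ i, l i * z i ^ 2 = w
    ring
  rw [h1, ← Finset.sum_filter_add_sum_filter_not univ (fun x : ZMod p => x ≠ 0), add_comm]
  congr 1
  · simp [Finset.filter_eq', ZMod.card]
  · rw [Finset.mul_sum]
    refine Finset.sum_congr rfl fun t ht => ?_
    rw [sum_stdChar_diagonal hp l 0 (Finset.mem_filter.1 ht).2, if_pos (by simp), diagGauss]
    simp
    ring

theorem card_quadric_hyperplane (l b : ι → ZMod p) (y c : ZMod p) :
    (p : ℂ) ^ 2 * #{z : ι → ZMod p | ∑ i, l i * z i ^ 2 = y ∧ ∑ i, b i * z i = c}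
      = ∑ t, ∑ x, stdChar p (-y * t - x * c) * ∑ z : ι → ZMod p,
          stdChar p (t * ∑ i, l i * z i ^ 2 + ∑ i, (x * b i) * z i) := by
  have h : ∀ z : ι → ZMod p,
      (p : ℂ) ^ 2 * (if ∑ i, l i * z i ^ 2 = y ∧ ∑ i, b i * z i = c then 1 else 0)
      = (if ∑ i, l i * z i ^ 2 - y = 0 then (p : ℂ) else 0)
        * (if ∑ i, b i * z i - c = 0 then (p : ℂ) else 0) := by
    intro z
    simp only [sub_eq_zero, ite_and]
    split_ifs <;> simp [pow_two]
  simp_rw [Finset.card_filter, Nat.cast_sum, Finset.mul_sum]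
  push_cast
  simp_rw [h, indicator_eq_sum_stdChar, Finset.sum_mul_sum]
  rw [Finset.sum_comm]
  refine Finset.sum_congr rfl fun t _ => ?_
  rw [Finset.sum_comm]
  refine Finset.sum_congr rfl fun x _ => Finset.sum_congr rfl fun z _ => ?_
  rw [← AddChar.map_add_eq_mul, ← AddChar.map_add_eq_mul]
  congr 1
  simp_rw [mul_assoc, ← Finset.mul_sum]
  ring

/-- At t = 0 only linear phases x·b remain, and since b ≠ 0 only x = 0 survives. -/
theorem sum_hyperplane_zero (b : ι → ZMod p) (hb : b ≠ 0) (l : ι → ZMod p) (y c : ZMod p) :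
    ∑ x, stdChar p (-y * 0 - x * c) * ∑ z : ι → ZMod p,
          stdChar p (0 * ∑ i, l i * z i ^ 2 + ∑ i, (x * b i) * z i)
      = (p : ℂ) ^ Fintype.card ι := by
  simp_rw [zero_mul, zero_add, sum_stdChar_linear]
  rw [Finset.sum_eq_single 0]
  · rw [if_pos (by ext; simp)]; simp
  · intro x _ hx
    rw [if_neg, mul_zero]
    intro h
    apply hb
    ext i
    simpa [hx] using congrFun h i
  · simp

/-- When b is nonzero on a radical coordinate, every frequency x ≠ 0 of the hyperplane gives 0, so c
plays no role: the quadric is equidistributed over the parallel hyperplanes. -/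
theorem card_quadric_hyperplane_of_not_mem (hp : p ≠ 2) (l b : ι → ZMod p)
    (hb : ¬ ∀ i, l i = 0 → b i = 0) (y c : ZMod p) :
    (p : ℂ) * #{z : ι → ZMod p | ∑ i, l i * z i ^ 2 = y ∧ ∑ i, b i * z i = c}
      = #{z : ι → ZMod p | ∑ i, l i * z i ^ 2 = y} := by
  have hp0 : (p : ℂ) ≠ 0 := Nat.cast_ne_zero.2 (Fact.out : p.Prime).ne_zero
  have hb0 : b ≠ 0 := by rintro rfl; simp at hb
  apply mul_left_cancel₀ hp0
  rw [card_quadric hp, ← mul_assoc, ← pow_two, card_quadric_hyperplane l b,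
    ← Finset.sum_filter_add_sum_filter_not univ (fun x : ZMod p => x ≠ 0), add_comm]
  congr 1
  · simp only [ne_eq, Decidable.not_not, Finset.filter_eq', Finset.mem_univ, if_true,
      Finset.sum_singleton]
    exact sum_hyperplane_zero b hb0 l y c
  · rw [Finset.mul_sum]
    refine Finset.sum_congr rfl fun t ht => ?_
    have ht := (Finset.mem_filter.1 ht).2
    simp_rw [sum_stdChar_diagonal hp l _ ht]
    rw [Finset.sum_eq_single 0]
    · simp [diagGauss]; ring
    · intro x _ hx
      rw [if_neg, mul_zero]
      simpa [hx] using hb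
    · simp

theorem card_quadric_hyperplane_of_mem (hp : p ≠ 2) (l b : ι → ZMod p) (hb0 : b ≠ 0)
    (hb : ∀ i, l i = 0 → b i = 0) (y c : ZMod p) :
    (p : ℂ) ^ 2 * #{z : ι → ZMod p | ∑ i, l i * z i ^ 2 = y ∧ ∑ i, b i * z i = c}
      = (p : ℂ) ^ Fintype.card ι + diagGauss l *
        ∑ t with t ≠ 0, legendreChar p t ^ #{i | l i ≠ 0} * stdChar p (-y * t)
          * (if ∑ i, (l i)⁻¹ * b i ^ 2 = 0 then (if c = 0 then (p : ℂ) else 0)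
            else legendreChar p (-∑ i, (l i)⁻¹ * b i ^ 2) * legendreChar p t * quadGauss p
              * stdChar p (c ^ 2 / (∑ i, (l i)⁻¹ * b i ^ 2) * t)) := by
  rw [card_quadric_hyperplane l b,
    ← Finset.sum_filter_add_sum_filter_not univ (fun x : ZMod p => x ≠ 0), add_comm]
  congr 1
  · simp only [ne_eq, Decidable.not_not, Finset.filter_eq', Finset.mem_univ, if_true,
      Finset.sum_singleton]
    exact sum_hyperplane_zero b hb0 l y c
  · rw [Finset.mul_sum]
    refine Finset.sum_congr rfl fun t ht => ?_
    have ht := (Finset.mem_filter.1 ht).2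
    rw [← sum_stdChar_section hp _ c ht, Finset.mul_sum, Finset.mul_sum]
    refine Finset.sum_congr rfl fun x _ => ?_
    rw [sum_stdChar_diagonal hp l _ ht, if_pos fun i hi => by simp [hb i hi], diagGauss]
    have h : -(x * c) - (4 * t)⁻¹ * ((∑ i, (l i)⁻¹ * b i ^ 2) * x ^ 2)
        = -(x * c) + -((4 * t)⁻¹ * ∑ i, (l i)⁻¹ * (x * b i) ^ 2) := by
      rw [Finset.sum_mul, sub_eq_add_neg]
      congr 3
      exact Finset.sum_congr rfl fun i _ => by ring
    rw [h, sub_eq_add_neg, AddChar.map_add_eq_mul, AddChar.map_add_eq_mul]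
    ring

/-- The number `ε (p*)^{-⌊r/2⌋}` of the diagonal quadratic form with coefficients `l`, where `r`
is its rank and `ε` its sign. -/
def formErr (l : ι → ZMod p) : ℚ :=
  quadraticChar (ZMod p) ((-1) ^ #{i | l i ≠ 0} * ∏ i with l i ≠ 0, l i)
    * (pStar p ^ (#{i | l i ≠ 0} / 2))⁻¹

/-- The normalized deviation of the number of points of a hyperplane section of a quadric of even
rank. -/
def evenTerm (s c y : ZMod p) : ℚ :=
  if s = 0 then (if c = 0 then (if y = 0 then (p : ℚ) else 0) - 1 else 0)
  else quadraticChar (ZMod p) (c ^ 2 - s * y)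

/-- The normalized deviation of the number of points of a hyperplane section of a quadric of odd
rank. -/
def oddTerm (s c y : ZMod p) : ℚ :=
  if s = 0 then (if c = 0 then (p : ℚ) * quadraticChar (ZMod p) (-y) else 0)
  else quadraticChar (ZMod p) (-s) * ((if c ^ 2 = s * y then (p : ℚ) else 0) - 1)

theorem cast_p_ne_zero : (p : ℚ) ≠ 0 := Nat.cast_ne_zero.2 (Fact.out : p.Prime).ne_zero

theorem pStar_eq (hp : p ≠ 2) : pStar p = quadraticChar (ZMod p) (-1) * p := by
  have h1 : p % 2 = 1 := Nat.odd_iff.1 ((Fact.out : p.Prime).odd_of_ne_two hp)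
  rw [quadraticChar_neg_one (ringChar_zmod_ne_two hp), ZMod.card, ZMod.χ₄_eq_neg_one_pow h1,
    pStar, show (p - 1) / 2 = p / 2 by omega]
  push_cast
  rfl

theorem pStar_ne_zero : pStar p ≠ 0 :=
  mul_ne_zero (pow_ne_zero _ (by norm_num)) cast_p_ne_zero

theorem pStar_sq : pStar p ^ 2 = (p : ℚ) ^ 2 := by
  rw [pStar, mul_pow, ← pow_mul, mul_comm _ 2, pow_mul]; norm_num

theorem quadGauss_sq_eq (hp : p ≠ 2) : quadGauss p ^ 2 = ((pStar p : ℚ) : ℂ) := by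
  rw [quadGauss_sq hp, pStar_eq hp, legendreChar_apply]
  push_cast
  rfl

theorem card_zero_add_card_ne_zero (l : ι → ZMod p) :
    Fintype.card ι = #{i | l i = 0} + #{i | l i ≠ 0} :=
  (Finset.card_filter_add_card_filter_not (s := univ) (fun i => l i = 0)).symm

/-- The square of the Gauss sum is p* and p² = p*², so p^r times (p*)^(-r/2) is the r-th power of
the Gauss sum. -/
theorem diagGauss_even (hp : p ≠ 2) (l : ι → ZMod p) (hr : Even #{i | l i ≠ 0}) :
    diagGauss l = (p : ℂ) ^ Fintype.card ι * ((formErr l : ℚ) : ℂ) := by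
  rw [card_zero_add_card_ne_zero l, diagGauss, formErr, hr.neg_one_pow, one_mul]
  obtain ⟨h, hh⟩ := hr
  rw [hh, ← two_mul, Nat.mul_div_cancel_left _ two_pos, pow_mul, quadGauss_sq_eq hp, pow_add,
    pow_mul (p : ℂ), legendreChar_apply]
  have h0 : ((pStar p : ℚ) : ℂ) ≠ 0 := Rat.cast_ne_zero.2 pStar_ne_zero
  have h1 : ((p : ℂ) ^ 2) = ((pStar p : ℚ) : ℂ) ^ 2 := by exact_mod_cast pStar_sq.symm
  rw [h1]
  push_cast
  rw [← pow_mul, mul_comm 2 h, pow_mul]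
  have := pow_ne_zero h h0
  field_simp

/-- One more Gauss sum makes the exponent even. The leftover factor p must become p* = η(-1)p, which
is what the (-1)^r in the definition of the sign supplies. -/
theorem diagGauss_odd (hp : p ≠ 2) (l : ι → ZMod p) (hr : Odd #{i | l i ≠ 0}) :
    diagGauss l * quadGauss p = (p : ℂ) ^ Fintype.card ι * ((formErr l : ℚ) : ℂ) := by
  rw [card_zero_add_card_ne_zero l, diagGauss, formErr, hr.neg_one_pow, map_mul]
  obtain ⟨h, hh⟩ := hr
  rw [hh, show (2 * h + 1) / 2 = h by omega, mul_assoc, ← pow_succ,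
    show 2 * h + 1 + 1 = 2 * (h + 1) by ring, pow_mul, quadGauss_sq_eq hp, pow_add,
    pow_add (p : ℂ), pow_succ (p : ℂ), pow_mul (p : ℂ), legendreChar_apply]
  have h0 : ((pStar p : ℚ) : ℂ) ≠ 0 := Rat.cast_ne_zero.2 pStar_ne_zero
  have h1 : ((p : ℂ) ^ 2) = ((pStar p : ℚ) : ℂ) ^ 2 := by exact_mod_cast pStar_sq.symm
  rw [h1, pow_one]
  have h2 : ((pStar p : ℚ) : ℂ) = ((quadraticChar (ZMod p) (-1) : ℤ) : ℂ) * (p : ℂ) := by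
    rw [pStar_eq hp]; push_cast; rfl
  push_cast
  rw [← pow_mul, mul_comm 2 h, pow_mul]
  have := pow_ne_zero h h0
  field_simp
  rw [h2]
  ring

/-- Passage from complex to rational identities; integer exponents are used because the exponent `n
- k` may be negative. -/
theorem eq_of_mul_cast {k : ℕ} {N : ℕ} {A : ℚ} {n : ℕ}
    (h : (p : ℂ) ^ k * (N : ℂ) = (p : ℂ) ^ n * (A : ℂ)) :
    (N : ℚ) = (p : ℚ) ^ ((n : ℤ) - k) * A := by
  have h1 : (p : ℚ) ^ k * (N : ℚ) = (p : ℚ) ^ n * A := by exact_mod_cast h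
  have h0 := cast_p_ne_zero (p := p)
  rw [zpow_sub₀ h0, zpow_natCast, zpow_natCast]
  field_simp
  linarith

theorem card_quadric_even (hp : p ≠ 2) (l : ι → ZMod p) (hr : Even #{i | l i ≠ 0})
    (y : ZMod p) :
    (#{z : ι → ZMod p | ∑ i, l i * z i ^ 2 = y} : ℚ)
      = (p : ℚ) ^ ((Fintype.card ι : ℤ) - 1)
        * (1 + formErr l * ((if y = 0 then (p : ℚ) else 0) - 1)) := by
  have h := eq_of_mul_cast (p := p) (k := 1) (n := Fintype.card ι)
    (N := #{z : ι → ZMod p | ∑ i, l i * z i ^ 2 = y})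
    (A := 1 + formErr l * ((if y = 0 then (p : ℚ) else 0) - 1))
  rw [pow_one, card_quadric hp, diagGauss_even hp l hr] at h
  refine h ?_
  have h1 : ∑ t with t ≠ 0, legendreChar p t ^ #{i | l i ≠ 0} * stdChar p (-y * t)
      = (if y = 0 then (p : ℂ) else 0) - 1 := by
    simp only [← neg_eq_zero (a := y)]
    rw [← sum_stdChar_mul_ne_zero]
    refine Finset.sum_congr rfl fun t ht => ?_
    obtain ⟨k, hk⟩ := hr
    rw [hk, ← two_mul, pow_mul, legendreChar_sq (Finset.mem_filter.1 ht).2, one_pow, one_mul]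
  rw [h1]
  split_ifs <;> push_cast <;> ring

theorem legendreChar_pow_odd {k : ℕ} (hk : Odd k) (t : ZMod p) :
    legendreChar p t ^ k = legendreChar p t := by
  obtain ⟨j, rfl⟩ := hk
  rcases eq_or_ne t 0 with rfl | ht
  · rw [MulChar.map_zero, zero_pow (by omega)]
  · rw [pow_succ, pow_mul, legendreChar_sq ht, one_pow, one_mul]

theorem card_quadric_odd (hp : p ≠ 2) (l : ι → ZMod p) (hr : Odd #{i | l i ≠ 0})
    (y : ZMod p) :
    (#{z : ι → ZMod p | ∑ i, l i * z i ^ 2 = y} : ℚ)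
      = (p : ℚ) ^ ((Fintype.card ι : ℤ) - 1)
        * (1 + formErr l * quadraticChar (ZMod p) (-y)) := by
  have h := eq_of_mul_cast (p := p) (k := 1) (n := Fintype.card ι)
    (N := #{z : ι → ZMod p | ∑ i, l i * z i ^ 2 = y})
    (A := 1 + formErr l * quadraticChar (ZMod p) (-y))
  rw [pow_one, card_quadric hp] at h
  refine h ?_
  simp_rw [legendreChar_pow_odd hr]
  rw [sum_legendreChar_mul_stdChar_ne_zero hp, legendreChar_apply, mul_comm _ (quadGauss p),
    ← mul_assoc, diagGauss_odd hp l hr]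
  push_cast
  ring

/-- For s ≠ 0 the factor η(t)^r is 1, and the section sum brings one η(t). The sum over t is then a
Gauss sum at c²/s - y; the two Gauss sums multiply to η(-1)p and the characters combine to η(c² -
sy). -/
theorem card_section_even (hp : p ≠ 2) (l b : ι → ZMod p) (hr : Even #{i | l i ≠ 0})
    (hb0 : b ≠ 0) (hb : ∀ i, l i = 0 → b i = 0) (y c : ZMod p) :
    (#{z : ι → ZMod p | ∑ i, l i * z i ^ 2 = y ∧ ∑ i, b i * z i = c} : ℚ)
      = (p : ℚ) ^ ((Fintype.card ι : ℤ) - 2)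
        * (1 + p * formErr l * evenTerm (∑ i, (l i)⁻¹ * b i ^ 2) c y) := by
  have h := eq_of_mul_cast (p := p) (k := 2) (n := Fintype.card ι)
    (N := #{z : ι → ZMod p | ∑ i, l i * z i ^ 2 = y ∧ ∑ i, b i * z i = c})
    (A := 1 + p * formErr l * evenTerm (∑ i, (l i)⁻¹ * b i ^ 2) c y)
  rw [card_quadric_hyperplane_of_mem hp l b hb0 hb, diagGauss_even hp l hr] at h
  refine h ?_
  generalize ∑ i, (l i)⁻¹ * b i ^ 2 = s
  have h1 : ∑ t with t ≠ 0, legendreChar p t ^ #{i | l i ≠ 0} * stdChar p (-y * t)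
          * (if s = 0 then (if c = 0 then (p : ℂ) else 0)
            else legendreChar p (-s) * legendreChar p t * quadGauss p
              * stdChar p (c ^ 2 / s * t)) = p * ((evenTerm s c y : ℚ) : ℂ) := by
    have h2 : ∀ t ∈ ({t | t ≠ 0} : Finset (ZMod p)),
        legendreChar p t ^ #{i | l i ≠ 0} = 1 := by
      intro t ht
      obtain ⟨k, hk⟩ := hr
      rw [hk, ← two_mul, pow_mul, legendreChar_sq (Finset.mem_filter.1 ht).2, one_pow]
    rw [Finset.sum_congr rfl fun t ht => by rw [h2 t ht, one_mul], evenTerm]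
    split_ifs with hs hc hy
    · rw [← Finset.sum_mul, sum_stdChar_mul_ne_zero, if_pos (neg_eq_zero.2 hy)]
      push_cast; ring
    · rw [← Finset.sum_mul, sum_stdChar_mul_ne_zero, if_neg (mt neg_eq_zero.1 hy)]
      push_cast; ring
    · simp
    · have h3 : ∀ t : ZMod p, stdChar p (-y * t) * (legendreChar p (-s) * legendreChar p t
          * quadGauss p * stdChar p (c ^ 2 / s * t)) = legendreChar p (-s) * quadGauss p *
            (legendreChar p t * stdChar p ((c ^ 2 / s - y) * t)) := by
        intro t
        rw [sub_mul, sub_eq_add_neg, AddChar.map_add_eq_mul, neg_mul]; ring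
      simp_rw [h3]
      rw [← Finset.mul_sum, sum_legendreChar_mul_stdChar_ne_zero hp]
      have h4 : c ^ 2 - s * y = s * (c ^ 2 / s - y) := by field_simp
      have h5 : ((quadraticChar (ZMod p) (c ^ 2 - s * y) : ℤ) : ℂ)
          = legendreChar p s * legendreChar p (c ^ 2 / s - y) := by
        rw [h4, ← legendreChar_apply, map_mul]
      have h6 : legendreChar p (-s) = legendreChar p (-1) * legendreChar p s := by
        rw [← map_mul, neg_one_mul]
      push_cast
      rw [h5, h6]
      have h7 := quadGauss_sq hp
      have h8 : legendreChar p (-1) ^ 2 = 1 := legendreChar_sq (by simp)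
      linear_combination (legendreChar p (-1) * legendreChar p s
        * legendreChar p (c ^ 2 / s - y)) * h7 + (p * legendreChar p s
        * legendreChar p (c ^ 2 / s - y)) * h8
  rw [h1]
  push_cast
  ring

/-- For s ≠ 0 the factor η(t) from the odd rank cancels the one from the section sum. A purely
additive sum over t ≠ 0 remains, which only sees whether c² = sy. -/
theorem card_section_odd (hp : p ≠ 2) (l b : ι → ZMod p) (hr : Odd #{i | l i ≠ 0})
    (hb0 : b ≠ 0) (hb : ∀ i, l i = 0 → b i = 0) (y c : ZMod p) :
    (#{z : ι → ZMod p | ∑ i, l i * z i ^ 2 = y ∧ ∑ i, b i * z i = c} : ℚ)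
      = (p : ℚ) ^ ((Fintype.card ι : ℤ) - 2)
        * (1 + formErr l * oddTerm (∑ i, (l i)⁻¹ * b i ^ 2) c y) := by
  have h := eq_of_mul_cast (p := p) (k := 2) (n := Fintype.card ι)
    (N := #{z : ι → ZMod p | ∑ i, l i * z i ^ 2 = y ∧ ∑ i, b i * z i = c})
    (A := 1 + formErr l * oddTerm (∑ i, (l i)⁻¹ * b i ^ 2) c y)
  rw [card_quadric_hyperplane_of_mem hp l b hb0 hb] at h
  refine h ?_
  generalize ∑ i, (l i)⁻¹ * b i ^ 2 = s
  simp_rw [legendreChar_pow_odd hr]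
  have h1 : ∑ t with t ≠ 0, legendreChar p t * stdChar p (-y * t)
          * (if s = 0 then (if c = 0 then (p : ℂ) else 0)
            else legendreChar p (-s) * legendreChar p t * quadGauss p
              * stdChar p (c ^ 2 / s * t)) = quadGauss p * ((oddTerm s c y : ℚ) : ℂ) := by
    rw [oddTerm]
    by_cases hs : s = 0
    · simp only [if_pos hs]
      rw [← Finset.sum_mul, sum_legendreChar_mul_stdChar_ne_zero hp, legendreChar_apply]
      split_ifs
      · push_cast; ring
      · simp
    · simp only [if_neg hs]
      have h3 : ∀ t ∈ ({t | t ≠ 0} : Finset (ZMod p)),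
          legendreChar p t * stdChar p (-y * t) * (legendreChar p (-s) * legendreChar p t
          * quadGauss p * stdChar p (c ^ 2 / s * t)) = legendreChar p (-s) * quadGauss p *
            stdChar p ((c ^ 2 / s - y) * t) := by
        intro t ht
        rw [sub_mul, sub_eq_add_neg, AddChar.map_add_eq_mul, neg_mul]
        linear_combination (legendreChar p (-s) * quadGauss p * stdChar p (c ^ 2 / s * t)
          * stdChar p (-(y * t))) * legendreChar_sq (Finset.mem_filter.1 ht).2
      have h4 : c ^ 2 / s - y = 0 ↔ c ^ 2 = s * y := by
        rw [sub_eq_zero, div_eq_iff hs, mul_comm]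
      rw [Finset.sum_congr rfl h3, ← Finset.mul_sum, sum_stdChar_mul_ne_zero,
        legendreChar_apply]
      simp only [h4]
      split_ifs <;> push_cast <;> ring
  rw [h1, ← mul_assoc, diagGauss_odd hp l hr]
  push_cast
  ring

theorem card_section_of_not_mem (hp : p ≠ 2) (l b : ι → ZMod p)
    (hb : ¬ ∀ i, l i = 0 → b i = 0) (y c : ZMod p) :
    (p : ℚ) * #{z : ι → ZMod p | ∑ i, l i * z i ^ 2 = y ∧ ∑ i, b i * z i = c}
      = #{z : ι → ZMod p | ∑ i, l i * z i ^ 2 = y} := by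
  exact_mod_cast card_quadric_hyperplane_of_not_mem hp l b hb y c

/-! ### Weights of the vectors b and the sizes of the classes (s, c) -/

/-- The number of points `z` of the quadric `∑ l_i z_i² = ∑ l_i u_i²` with `b · z ≠ b · u`. -/
def diagWeight (l u b : ι → ZMod p) : ℕ :=
  #{z : ι → ZMod p | ∑ i, l i * z i ^ 2 = ∑ i, l i * u i ^ 2 ∧ ∑ i, b i * z i ≠ ∑ i, b i * u i}

theorem diagWeight_zero (l u : ι → ZMod p) : diagWeight l u 0 = 0 := by
  simp [diagWeight]

theorem diagWeight_eq (l u b : ι → ZMod p) :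
    (diagWeight l u b : ℚ) = #{z : ι → ZMod p | ∑ i, l i * z i ^ 2 = ∑ i, l i * u i ^ 2}
      - #{z : ι → ZMod p | ∑ i, l i * z i ^ 2 = ∑ i, l i * u i ^ 2
          ∧ ∑ i, b i * z i = ∑ i, b i * u i} := by
  rw [eq_sub_iff_add_eq, add_comm]
  have h := Finset.card_filter_add_card_filter_not
    (s := ({z : ι → ZMod p | ∑ i, l i * z i ^ 2 = ∑ i, l i * u i ^ 2} : Finset _))
    (fun z => ∑ i, b i * z i = ∑ i, b i * u i)
  rw [Finset.filter_filter, Finset.filter_filter] at h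
  exact_mod_cast h

theorem diagWeight_of_not_mem (hp : p ≠ 2) (l u b : ι → ZMod p)
    (hb : ¬ ∀ i, l i = 0 → b i = 0) :
    (diagWeight l u b : ℚ) =
      #{z : ι → ZMod p | ∑ i, l i * z i ^ 2 = ∑ i, l i * u i ^ 2} * (1 - (p : ℚ)⁻¹) := by
  have h0 := cast_p_ne_zero (p := p)
  rw [diagWeight_eq, ← card_section_of_not_mem hp l b hb _ (∑ i, b i * u i)]
  field_simp

theorem sum_subtype_ne_zero (l g : ι → ZMod p) (hg : ∀ i, l i = 0 → g i = 0) :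
    ∑ j : {i // l i ≠ 0}, g j = ∑ i, g i := by
  rw [← Finset.sum_filter_of_ne (p := fun i => l i ≠ 0) (fun i _ h hl => h (hg i hl)),
    Finset.sum_subtype _ (p := fun i => l i ≠ 0) (by simp)]

theorem card_subtype_inv (l : ι → ZMod p) :
    #{j : {i // l i ≠ 0} | (l j)⁻¹ ≠ 0} = #{i | l i ≠ 0} := by
  rw [Finset.filter_true_of_mem fun j _ => inv_ne_zero j.2, Finset.card_univ,
    Fintype.card_subtype]

/-- Inverting the coefficients changes neither the rank nor the quadratic character of their
product, so the dual form on the support has the same normalized sign. -/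
theorem formErr_inv (l : ι → ZMod p) :
    formErr (fun j : {i // l i ≠ 0} => (l j)⁻¹) = formErr l := by
  have h2 : ∏ j ∈ univ.filter (fun j : {i // l i ≠ 0} => (l j)⁻¹ ≠ 0), (l j)⁻¹
      = (∏ i with l i ≠ 0, l i)⁻¹ := by
    rw [Finset.filter_true_of_mem fun j _ => inv_ne_zero j.2, Finset.prod_inv_distrib,
      Finset.prod_subtype ({i | l i ≠ 0}) (p := fun i => l i ≠ 0) (by simp)]
  have h3 : ∀ x : ZMod p, quadraticChar (ZMod p) x⁻¹ = quadraticChar (ZMod p) x := by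
    intro x
    have := legendreChar_inv x
    rw [legendreChar_apply, legendreChar_apply] at this
    exact_mod_cast this
  rw [formErr, formErr, card_subtype_inv, h2, map_mul, h3, ← map_mul]

/-- Vectors b vanishing on the radical coordinates are vectors on the support of l. There the two
conditions cut out a hyperplane section of the dual quadric, with u as the normal vector, so the
section formulas apply again. -/
theorem card_image_fiber (l u : ι → ZMod p) (s c : ZMod p) :
    #{b : ι → ZMod p | (∀ i, l i = 0 → b i = 0) ∧ ∑ i, (l i)⁻¹ * b i ^ 2 = s
        ∧ ∑ i, b i * u i = c}
      = #{z : {i // l i ≠ 0} → ZMod p |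
          ∑ j : {i // l i ≠ 0}, (l j)⁻¹ * z j ^ 2 = s ∧ ∑ j : {i // l i ≠ 0}, u j * z j = c} := by
  have hsum := sum_subtype_ne_zero l
  refine Finset.card_bij' (fun b _ j => b j)
    (fun z _ i => if h : l i ≠ 0 then z ⟨i, h⟩ else 0) ?_ ?_ ?_ ?_
  · intro b hb
    simp only [Finset.mem_filter, Finset.mem_univ, true_and] at hb ⊢
    obtain ⟨h, h1, h2⟩ := hb
    rw [← h1, ← h2, ← hsum _ fun i hi => by simp [h i hi], ← hsum _ fun i hi => by simp [h i hi]]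
    exact ⟨rfl, Finset.sum_congr rfl fun j _ => mul_comm _ _⟩
  · intro z hz
    simp only [Finset.mem_filter, Finset.mem_univ, true_and] at hz ⊢
    refine ⟨fun i hi => by simp [hi], ?_, ?_⟩
    · rw [← hz.1, ← hsum _ fun i hi => by simp [hi]]
      refine Finset.sum_congr rfl fun j _ => ?_
      rw [dif_pos j.2]
    · rw [← hz.2, ← hsum _ fun i hi => by simp [hi]]
      refine Finset.sum_congr rfl fun j _ => ?_
      rw [dif_pos j.2, mul_comm]
  · intro b hb
    simp only [Finset.mem_filter, Finset.mem_univ, true_and] at hb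
    ext i
    by_cases h : l i = 0
    · simp [h, hb.1 i h]
    · simp [h]
  · intro z _
    ext j
    simp [j.2]

theorem sum_support (l u : ι → ZMod p) :
    ∑ j : {i // l i ≠ 0}, ((l j)⁻¹)⁻¹ * u j ^ 2 = ∑ i, l i * u i ^ 2 := by
  simp_rw [inv_inv]
  exact sum_subtype_ne_zero l (fun i => l i * u i ^ 2) fun i hi => by simp [hi]

/-- The dual of the dual form is the original one, so the value attached to the normal vector u is ∑
l_i u_i². Compared with the weight formula, the first and last arguments of `evenTerm` are
exchanged. -/
theorem card_image_fiber_even (hp : p ≠ 2) (l u : ι → ZMod p) (hr : Even #{i | l i ≠ 0})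
    (hu : ∃ i, l i ≠ 0 ∧ u i ≠ 0) (s c : ZMod p) :
    (#{b : ι → ZMod p | (∀ i, l i = 0 → b i = 0) ∧ ∑ i, (l i)⁻¹ * b i ^ 2 = s
        ∧ ∑ i, b i * u i = c} : ℚ)
      = (p : ℚ) ^ ((#{i | l i ≠ 0} : ℤ) - 2)
        * (1 + p * formErr l * evenTerm (∑ i, l i * u i ^ 2) c s) := by
  obtain ⟨i, hi, hui⟩ := hu
  rw [card_image_fiber, card_section_even hp (fun j : {i // l i ≠ 0} => (l j)⁻¹) (fun j => u j)
    (by rwa [card_subtype_inv]) (fun h => hui (congrFun h ⟨i, hi⟩))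
    (fun j hj => absurd hj (inv_ne_zero j.2)), formErr_inv, sum_support, Fintype.card_subtype]

theorem card_image_fiber_odd (hp : p ≠ 2) (l u : ι → ZMod p) (hr : Odd #{i | l i ≠ 0})
    (hu : ∃ i, l i ≠ 0 ∧ u i ≠ 0) (s c : ZMod p) :
    (#{b : ι → ZMod p | (∀ i, l i = 0 → b i = 0) ∧ ∑ i, (l i)⁻¹ * b i ^ 2 = s
        ∧ ∑ i, b i * u i = c} : ℚ)
      = (p : ℚ) ^ ((#{i | l i ≠ 0} : ℤ) - 2)
        * (1 + formErr l * oddTerm (∑ i, l i * u i ^ 2) c s) := by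
  obtain ⟨i, hi, hui⟩ := hu
  rw [card_image_fiber, card_section_odd hp (fun j : {i // l i ≠ 0} => (l j)⁻¹) (fun j => u j)
    (by rwa [card_subtype_inv]) (fun h => hui (congrFun h ⟨i, hi⟩))
    (fun j hj => absurd hj (inv_ne_zero j.2)), formErr_inv, sum_support, Fintype.card_subtype]

theorem card_image (l : ι → ZMod p) :
    #{b : ι → ZMod p | ∀ i, l i = 0 → b i = 0} = p ^ #{i | l i ≠ 0} := by
  have h : ({b : ι → ZMod p | ∀ i, l i = 0 → b i = 0} : Finset (ι → ZMod p))
      = Fintype.piFinset fun i => if l i ≠ 0 then univ else {0} := by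
    ext b
    simp only [Finset.mem_filter, Finset.mem_univ, true_and, Fintype.mem_piFinset]
    refine forall_congr' fun i => ?_
    split_ifs with h <;> simp_all
  rw [h, Fintype.card_piFinset]
  simp_rw [apply_ite Finset.card]
  rw [Finset.prod_ite]
  simp [ZMod.card]

/-- `HasDiagDistribution l u T` says that the weights `diagWeight l u b` are distributed as listed
in the table `T` and that only `b = 0` has weight `0`. -/
def HasDiagDistribution (l u : ι → ZMod p) (T : List (ℚ × ℚ)) : Prop :=
  (∀ b, diagWeight l u b = 0 → b = 0) ∧
    (∀ t ∈ T, (#{b | (diagWeight l u b : ℚ) = t.1} : ℚ) = t.2) ∧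
      ∀ b, ∃ t ∈ T, (diagWeight l u b : ℚ) = t.1

/-- Vectors vanishing on the radical coordinates are counted class by class. The vector b = 0 lies
in class (0, 0) but has weight 0 ≠ W, hence the subtraction; the p^m - p^r remaining vectors all
have weight `w`. -/
theorem card_diagWeight_eq {l u : ι → ZMod p} {w : ℚ} {f M : ZMod p → ZMod p → ℚ}
    (hout : ∀ b, (¬ ∀ i, l i = 0 → b i = 0) → (diagWeight l u b : ℚ) = w)
    (hin : ∀ b, b ≠ 0 → (∀ i, l i = 0 → b i = 0) →
      (diagWeight l u b : ℚ) = f (∑ i, (l i)⁻¹ * b i ^ 2) (∑ i, b i * u i))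
    (hM : ∀ s c, (#{b : ι → ZMod p | (∀ i, l i = 0 → b i = 0) ∧ ∑ i, (l i)⁻¹ * b i ^ 2 = s
        ∧ ∑ i, b i * u i = c} : ℚ) = M s c) {W : ℚ} (hW : W ≠ 0) :
    (#{b | (diagWeight l u b : ℚ) = W} : ℚ)
      = (∑ s, ∑ c, if f s c = W then M s c else 0) - (if f 0 0 = W then 1 else 0)
        + (if w = W then (p : ℚ) ^ Fintype.card ι - (p : ℚ) ^ #{i | l i ≠ 0} else 0) := by
  have h1 : (∑ s, ∑ c, if f s c = W then M s c else 0)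
      = #{b : ι → ZMod p | (∀ i, l i = 0 → b i = 0) ∧
          f (∑ i, (l i)⁻¹ * b i ^ 2) (∑ i, b i * u i) = W} := by
    have h2 : ∀ s c, (if f s c = W then M s c else 0)
        = ∑ b : ι → ZMod p, if ∀ i, l i = 0 → b i = 0 then
            (if ∑ i, (l i)⁻¹ * b i ^ 2 = s then (if ∑ i, b i * u i = c then
              (if f s c = W then 1 else 0) else 0) else 0) else 0 := by
      intro s c
      rw [← hM, Finset.card_filter]
      split_ifs
      · push_cast
        simp only [ite_and]
      · simp
    simp_rw [h2]
    rw [Finset.sum_congr rfl fun s _ => Finset.sum_comm, Finset.sum_comm, Finset.card_filter]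
    push_cast
    refine Finset.sum_congr rfl fun b _ => ?_
    by_cases hb : ∀ i, l i = 0 → b i = 0
    · simp only [eq_true hb, if_true, true_and]
      simp
    · simp [hb]
  have h3 : ∀ b : ι → ZMod p, (if (diagWeight l u b : ℚ) = W then (1 : ℚ) else 0)
      = (if (∀ i, l i = 0 → b i = 0) ∧ f (∑ i, (l i)⁻¹ * b i ^ 2) (∑ i, b i * u i) = W
          then 1 else 0) - (if b = 0 then (if f 0 0 = W then 1 else 0) else 0)
        + (if w = W then (1 - if ∀ i, l i = 0 → b i = 0 then 1 else 0) else 0) := by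
    intro b
    by_cases hb : ∀ i, l i = 0 → b i = 0
    · rcases eq_or_ne b 0 with rfl | hb0
      · simp [diagWeight_zero, hW.symm]
      · rw [hin b hb0 hb]
        simp only [eq_true hb, hb0, if_true, if_false, true_and]
        simp
    · have hb0 : b ≠ 0 := by rintro rfl; simp at hb
      simp [hout b hb, hb, hb0]
  rw [h1, Finset.card_filter, Finset.card_filter]
  push_cast
  simp_rw [h3]
  rw [Finset.sum_add_distrib, Finset.sum_sub_distrib]
  congr 1
  · congr 1
    simp
  · split_ifs
    · have h4 : (∑ b : ι → ZMod p, if ∀ i, l i = 0 → b i = 0 then (1 : ℚ) else 0)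
          = (p : ℚ) ^ #{i | l i ≠ 0} := by
        rw [Finset.sum_boole, card_image]
        push_cast; rfl
      rw [Finset.sum_sub_distrib, h4, sub_left_inj]
      simp [ZMod.card]
    · simp

/-! ### Elementary counts of residues and of pairs (s, c) -/

theorem three_le_cast (hp : p ≠ 2) : (3 : ℚ) ≤ p := by
  have h1 := (Fact.out : p.Prime).two_le
  exact_mod_cast (show 3 ≤ p by omega)

theorem quadraticChar_cases (x : ZMod p) :
    x = 0 ∨ (x ≠ 0 ∧ quadraticChar (ZMod p) x = 1) ∨ (x ≠ 0 ∧ quadraticChar (ZMod p) x = -1) := by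
  by_cases hx : x = 0
  · exact Or.inl hx
  · rcases quadraticChar_dichotomy hx with h | h
    · exact Or.inr (Or.inl ⟨hx, h⟩)
    · exact Or.inr (Or.inr ⟨hx, h⟩)

theorem sum_quadraticChar_eq_one (hp : p ≠ 2) :
    ∑ x : ZMod p, (if quadraticChar (ZMod p) x = 1 then (1 : ℚ) else 0) = (p - 1) / 2 := by
  have h : ∀ x : ZMod p, (if quadraticChar (ZMod p) x = 1 then (1 : ℚ) else 0)
      = (1 - (if x = 0 then 1 else 0) + (quadraticChar (ZMod p) x : ℤ)) / 2 := by
    intro x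
    rcases quadraticChar_cases x with rfl | ⟨hx, h⟩ | ⟨hx, h⟩ <;> simp [*]
  simp_rw [h]
  rw [← Finset.sum_div, Finset.sum_add_distrib, Finset.sum_sub_distrib]
  have h2 : ∑ x : ZMod p, ((quadraticChar (ZMod p) x : ℤ) : ℚ) = 0 := by
    exact_mod_cast quadraticChar_sum_zero (ringChar_zmod_ne_two hp)
  rw [h2]
  simp [ZMod.card]

theorem sum_quadraticChar_eq_neg_one (hp : p ≠ 2) :
    ∑ x : ZMod p, (if quadraticChar (ZMod p) x = -1 then (1 : ℚ) else 0) = (p - 1) / 2 := by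
  have h : ∀ x : ZMod p, (if quadraticChar (ZMod p) x = -1 then (1 : ℚ) else 0)
      = 1 - (if x = 0 then 1 else 0) - (if quadraticChar (ZMod p) x = 1 then (1 : ℚ) else 0) := by
    intro x
    rcases quadraticChar_cases x with rfl | ⟨hx, h⟩ | ⟨hx, h⟩ <;> simp [*]
  simp_rw [h]
  rw [Finset.sum_sub_distrib, sum_quadraticChar_eq_one hp, Finset.sum_sub_distrib]
  simp [ZMod.card]
  ring

theorem sum_comp_mul {y : ZMod p} (hy : y ≠ 0) (g : ZMod p → ℚ) :
    ∑ s, g (s * y) = ∑ s, g s :=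
  Equiv.sum_comp (Equiv.mulRight₀ y hy) g

theorem sum_comp_neg (g : ZMod p → ℚ) : ∑ s, g (-s) = ∑ s, g s :=
  Equiv.sum_comp (Equiv.neg _) g

theorem sum_comp_sub (g : ZMod p → ℚ) (a : ZMod p) : ∑ s, g (a - s) = ∑ s, g s :=
  Equiv.sum_comp (Equiv.subLeft a) g

/-- For fixed c the map s ↦ c² - sy is a bijection, so each value of the discriminant is taken p
times. -/
theorem sum_comp_disc {y : ZMod p} (hy : y ≠ 0) (g : ZMod p → ℚ) :
    ∑ s, ∑ c, g (c ^ 2 - s * y) = p * ∑ t, g t := by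
  rw [Finset.sum_comm]
  have h : ∀ c : ZMod p, ∑ s, g (c ^ 2 - s * y) = ∑ t, g t := fun c => by
    rw [sum_comp_mul hy fun t => g (c ^ 2 - t), sum_comp_sub]
  simp [h, ZMod.card]

theorem sum_indicator_ne_zero :
    ∑ c : ZMod p, (if c ≠ 0 then (1 : ℚ) else 0) = p - 1 := by
  have h : ∀ c : ZMod p, (if c ≠ 0 then (1 : ℚ) else 0) = 1 - if c = 0 then 1 else 0 := by
    intro c; split_ifs <;> simp_all
  simp_rw [h]
  rw [Finset.sum_sub_distrib]
  simp [ZMod.card]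

theorem sum_indicator_disc_zero {y : ZMod p} (hy : y ≠ 0) :
    ∑ s : ZMod p, ∑ c : ZMod p, (if c ^ 2 = s * y ∧ c ≠ 0 then (1 : ℚ) else 0) = p - 1 := by
  rw [Finset.sum_comm, ← sum_indicator_ne_zero]
  refine Finset.sum_congr rfl fun c _ => ?_
  rw [Finset.sum_eq_single (c ^ 2 / y)]
  · simp [hy]
  · intro s _ hs
    rw [if_neg]
    rintro ⟨h, -⟩
    exact hs (by rw [h]; field_simp)
  · simp

/-- The sign squares to 1 and p*² = p². This fixes the absolute value of e and supplies the bounds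
that keep weights away from 0. -/
theorem formErr_sq_mul (l : ι → ZMod p) :
    formErr l ^ 2 * (p : ℚ) ^ (2 * (#{i | l i ≠ 0} / 2)) = 1 := by
  rw [formErr]
  generalize #{i | l i ≠ 0} / 2 = h
  have h1 : (quadraticChar (ZMod p) ((-1) ^ #{i | l i ≠ 0} * ∏ i with l i ≠ 0, l i)) ^ 2 = 1 := by
    apply quadraticChar_sq_one
    refine mul_ne_zero (pow_ne_zero _ (by simp)) (Finset.prod_ne_zero_iff.2 fun i hi => ?_)
    exact (Finset.mem_filter.1 hi).2
  have h2 : (((quadraticChar (ZMod p) ((-1) ^ #{i | l i ≠ 0} * ∏ i with l i ≠ 0, l i) : ℤ) : ℚ)) ^ 2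
      = 1 := by exact_mod_cast h1
  rw [mul_pow, h2, one_mul, pow_mul, ← pStar_sq, inv_pow, ← pow_mul, ← pow_mul, mul_comm h 2]
  exact inv_mul_cancel₀ (pow_ne_zero _ pStar_ne_zero)

theorem formErr_ne_zero (l : ι → ZMod p) : formErr l ≠ 0 := by
  intro h
  have := formErr_sq_mul l
  rw [h] at this
  norm_num at this

/-- Every b ≠ 0 has a weight listed in T, and these are nonzero, so the row (0, 1) accounts for b =
0 alone. -/
theorem hasDiagDistribution_cons {l u : ι → ZMod p} {w : ℚ} {f M : ZMod p → ZMod p → ℚ}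
    (hout : ∀ b, (¬ ∀ i, l i = 0 → b i = 0) → (diagWeight l u b : ℚ) = w)
    (hin : ∀ b, b ≠ 0 → (∀ i, l i = 0 → b i = 0) →
      (diagWeight l u b : ℚ) = f (∑ i, (l i)⁻¹ * b i ^ 2) (∑ i, b i * u i))
    (hM : ∀ s c, (#{b : ι → ZMod p | (∀ i, l i = 0 → b i = 0) ∧ ∑ i, (l i)⁻¹ * b i ^ 2 = s
        ∧ ∑ i, b i * u i = c} : ℚ) = M s c)
    (T : List (ℚ × ℚ)) (hT : ∀ t ∈ T, t.1 ≠ 0)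
    (hw : ∃ t ∈ T, w = t.1) (hf : ∀ s c, ∃ t ∈ T, f s c = t.1)
    (hcard : ∀ t ∈ T, (∑ s, ∑ c, if f s c = t.1 then M s c else 0) - (if f 0 0 = t.1 then 1 else 0)
        + (if w = t.1 then (p : ℚ) ^ Fintype.card ι - (p : ℚ) ^ #{i | l i ≠ 0} else 0) = t.2) :
    HasDiagDistribution l u ((0, 1) :: T) := by
  have hex : ∀ b, b ≠ 0 → ∃ t ∈ T, (diagWeight l u b : ℚ) = t.1 := by
    intro b hb
    by_cases h : ∀ i, l i = 0 → b i = 0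
    · rw [hin b hb h]; exact hf _ _
    · rw [hout b h]; exact hw
  have h0 : ∀ b, diagWeight l u b = 0 → b = 0 := by
    intro b hb
    by_contra hb0
    obtain ⟨t, ht, h⟩ := hex b hb0
    exact hT t ht (by rw [← h, hb, Nat.cast_zero])
  refine ⟨h0, ?_, fun b => ?_⟩
  · rw [List.forall_mem_cons]
    constructor
    · have : ({b | (diagWeight l u b : ℚ) = 0} : Finset (ι → ZMod p)) = {0} := by
        ext b
        simp only [Nat.cast_eq_zero, Finset.mem_filter, Finset.mem_univ, true_and,
          Finset.mem_singleton]
        exact ⟨h0 b, by rintro rfl; exact diagWeight_zero l u⟩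
      simp only [this, Finset.card_singleton, Nat.cast_one]
    · intro t ht
      rw [card_diagWeight_eq hout hin hM (hT t ht), hcard t ht]
  · rcases eq_or_ne b 0 with rfl | hb
    · exact ⟨(0, 1), List.mem_cons_self, by simp [diagWeight_zero]⟩
    · obtain ⟨t, ht, h⟩ := hex b hb
      exact ⟨t, List.mem_cons_of_mem _ ht, h⟩

/-- The class contains b = 0. Inserted into the closed formula for the class size, this gives
inequalities on e that exclude vanishing weights. -/
theorem image_fiber_zero_pos (l u : ι → ZMod p) :
    (0 : ℚ) < #{b : ι → ZMod p | (∀ i, l i = 0 → b i = 0) ∧ ∑ i, (l i)⁻¹ * b i ^ 2 = 0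
        ∧ ∑ i, b i * u i = 0} := by
  exact_mod_cast Finset.card_pos.2 ⟨0, by simp⟩

theorem cast_zpow_succ (k : ℤ) : (p : ℚ) ^ (k - 1) = p ^ (k - 2) * p := by
  rw [← zpow_add_one₀ cast_p_ne_zero]; congr 1; ring

theorem cast_zpow_pos (k : ℤ) : (0 : ℚ) < (p : ℚ) ^ k :=
  zpow_pos (by exact_mod_cast (Fact.out : p.Prime).pos) k

/-- Weights are an injective affine function of the normalized deviation `g s c`, so equality of
weights can be tested on the few values of `g`. The number `w` is the value assigned to vectors b
outside the image. -/
theorem hasDiagDistribution_affine {l u : ι → ZMod p} {P A B w : ℚ}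
    {g M : ZMod p → ZMod p → ℚ} (hP : P ≠ 0) (hB : B ≠ 0)
    (hout : ∀ b, (¬ ∀ i, l i = 0 → b i = 0) → (diagWeight l u b : ℚ) = P * (A + B * w))
    (hin : ∀ b, b ≠ 0 → (∀ i, l i = 0 → b i = 0) → (diagWeight l u b : ℚ)
      = P * (A + B * g (∑ i, (l i)⁻¹ * b i ^ 2) (∑ i, b i * u i)))
    (hM : ∀ s c, (#{b : ι → ZMod p | (∀ i, l i = 0 → b i = 0) ∧ ∑ i, (l i)⁻¹ * b i ^ 2 = s
        ∧ ∑ i, b i * u i = c} : ℚ) = M s c)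
    (T : List (ℚ × ℚ)) (hT : ∀ t ∈ T, A + B * t.1 ≠ 0)
    (hw : ∃ t ∈ T, w = t.1) (hg : ∀ s c, ∃ t ∈ T, g s c = t.1)
    (hcard : ∀ t ∈ T, (∑ s, ∑ c, if g s c = t.1 then M s c else 0) - (if g 0 0 = t.1 then 1 else 0)
        + (if w = t.1 then (p : ℚ) ^ Fintype.card ι - (p : ℚ) ^ #{i | l i ≠ 0} else 0) = t.2) :
    HasDiagDistribution l u ((0, 1) :: T.map fun t => (P * (A + B * t.1), t.2)) := by
  have hF : ∀ x y : ℚ, P * (A + B * x) = P * (A + B * y) ↔ x = y := by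
    intro x y
    rw [mul_right_inj' hP, add_right_inj, mul_right_inj' hB]
  refine hasDiagDistribution_cons (f := fun s c => P * (A + B * g s c)) hout hin hM _ ?_ ?_ ?_ ?_
  · intro t ht
    obtain ⟨x, hx, rfl⟩ := List.mem_map.1 ht
    exact mul_ne_zero hP (hT x hx)
  · obtain ⟨t, ht, h⟩ := hw
    exact ⟨_, List.mem_map_of_mem ht, by simp only [h]⟩
  · intro s c
    obtain ⟨t, ht, h⟩ := hg s c
    exact ⟨_, List.mem_map_of_mem ht, by simp only [h]⟩
  · intro t ht
    obtain ⟨x, hx, rfl⟩ := List.mem_map.1 ht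
    simp only [hF]
    exact hcard x hx

theorem sum_sum_eq_add {g h₁ h₂ : ZMod p → ZMod p → ℚ} (a b : ℚ) {k₁ k₂ : ℚ}
    (h : ∀ s c, g s c = a * h₁ s c + b * h₂ s c) (hk₁ : ∑ s, ∑ c, h₁ s c = k₁)
    (hk₂ : ∑ s, ∑ c, h₂ s c = k₂) : ∑ s, ∑ c, g s c = a * k₁ + b * k₂ := by
  simp_rw [h, Finset.sum_add_distrib, ← Finset.mul_sum]
  rw [hk₁, hk₂]

theorem sum_sum_eq_mul {g h : ZMod p → ZMod p → ℚ} (a : ℚ) {k : ℚ}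
    (hgh : ∀ s c, g s c = a * h s c) (hk : ∑ s, ∑ c, h s c = k) :
    ∑ s, ∑ c, g s c = a * k := by
  simp_rw [hgh, ← Finset.mul_sum]
  rw [hk]

theorem cons_pair_congr {a a' b b' : ℚ} {T T' : List (ℚ × ℚ)} (ha : a = a') (hb : b = b')
    (hT : T = T') : (a, b) :: T = (a', b') :: T' := by
  rw [ha, hb, hT]

theorem sum_indicator_and (P Q : ZMod p → Prop) [DecidablePred P] [DecidablePred Q] :
    ∑ s : ZMod p, ∑ c : ZMod p, (if P s ∧ Q c then (1 : ℚ) else 0)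
      = (∑ s, if P s then 1 else 0) * ∑ c, if Q c then 1 else 0 := by
  rw [Finset.sum_mul_sum]
  refine Finset.sum_congr rfl fun s _ => Finset.sum_congr rfl fun c _ => ?_
  split_ifs <;> simp_all

theorem sum_zero_ne_zero :
    ∑ s : ZMod p, ∑ c : ZMod p, (if s = 0 ∧ c ≠ 0 then (1 : ℚ) else 0) = p - 1 := by
  rw [sum_indicator_and (fun s => s = 0) fun c => c ≠ 0, sum_indicator_ne_zero]
  simp

theorem sum_ne_zero_zero :
    ∑ s : ZMod p, ∑ c : ZMod p, (if s ≠ 0 ∧ c = 0 then (1 : ℚ) else 0) = p - 1 := by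
  rw [sum_indicator_and (fun s => s ≠ 0) fun c => c = 0, sum_indicator_ne_zero]
  simp

theorem sum_ne_zero_ne_zero :
    ∑ s : ZMod p, ∑ c : ZMod p, (if s ≠ 0 ∧ c ≠ 0 then (1 : ℚ) else 0) = (p - 1) ^ 2 := by
  rw [sum_indicator_and (fun s => s ≠ 0) fun c => c ≠ 0, sum_indicator_ne_zero, pow_two]

theorem sum_zero_zero :
    ∑ s : ZMod p, ∑ c : ZMod p, (if s = 0 ∧ c = 0 then (1 : ℚ) else 0) = 1 := by
  simp [ite_and]

theorem sum_quadraticChar_neg_eq_one (hp : p ≠ 2) :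
    ∑ x : ZMod p, (if quadraticChar (ZMod p) (-x) = 1 then (1 : ℚ) else 0) = (p - 1) / 2 := by
  rw [sum_comp_neg fun x => if quadraticChar (ZMod p) x = 1 then (1 : ℚ) else 0,
    sum_quadraticChar_eq_one hp]

theorem sum_quadraticChar_neg_eq_neg_one (hp : p ≠ 2) :
    ∑ x : ZMod p, (if quadraticChar (ZMod p) (-x) = -1 then (1 : ℚ) else 0) = (p - 1) / 2 := by
  rw [sum_comp_neg fun x => if quadraticChar (ZMod p) x = -1 then (1 : ℚ) else 0,
    sum_quadraticChar_eq_neg_one hp]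

theorem sum_mul_eq_one (hp : p ≠ 2) {y : ZMod p} (hy : y ≠ 0) :
    ∑ s : ZMod p, ∑ _c : ZMod p, (if quadraticChar (ZMod p) (s * y) = 1 then (1 : ℚ) else 0)
      = p * ((p - 1) / 2) := by
  rw [Finset.sum_comm,
    sum_comp_mul hy fun t => if quadraticChar (ZMod p) t = 1 then (1 : ℚ) else 0,
    sum_quadraticChar_eq_one hp]
  simp [ZMod.card]

theorem sum_mul_eq_neg_one (hp : p ≠ 2) {y : ZMod p} (hy : y ≠ 0) :
    ∑ s : ZMod p, ∑ _c : ZMod p, (if quadraticChar (ZMod p) (s * y) = -1 then (1 : ℚ) else 0)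
      = p * ((p - 1) / 2) := by
  rw [Finset.sum_comm,
    sum_comp_mul hy fun t => if quadraticChar (ZMod p) t = -1 then (1 : ℚ) else 0,
    sum_quadraticChar_eq_neg_one hp]
  simp [ZMod.card]

theorem sum_disc_eq_one (hp : p ≠ 2) {y : ZMod p} (hy : y ≠ 0) :
    ∑ s : ZMod p, ∑ c : ZMod p,
      (if quadraticChar (ZMod p) (c ^ 2 - s * y) = 1 then (1 : ℚ) else 0)
        = p * ((p - 1) / 2) := by
  rw [sum_comp_disc hy fun t => if quadraticChar (ZMod p) t = 1 then (1 : ℚ) else 0,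
    sum_quadraticChar_eq_one hp]

theorem sum_disc_eq_neg_one (hp : p ≠ 2) {y : ZMod p} (hy : y ≠ 0) :
    ∑ s : ZMod p, ∑ c : ZMod p,
      (if quadraticChar (ZMod p) (c ^ 2 - s * y) = -1 then (1 : ℚ) else 0)
        = p * ((p - 1) / 2) := by
  rw [sum_comp_disc hy fun t => if quadraticChar (ZMod p) t = -1 then (1 : ℚ) else 0,
    sum_quadraticChar_eq_neg_one hp]

/-! ### The weight tables for even rank -/

theorem evenTerm_cases {y : ZMod p} (hy : y ≠ 0) (s c : ZMod p) :
    (s = 0 ∧ c = 0 ∧ c ^ 2 = s * y ∧ quadraticChar (ZMod p) (c ^ 2 - s * y) = 0 ∧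
      evenTerm s c y = -1) ∨
    (s = 0 ∧ c ≠ 0 ∧ c ^ 2 ≠ s * y ∧ quadraticChar (ZMod p) (c ^ 2 - s * y) = 1 ∧
      evenTerm s c y = 0) ∨
    (s ≠ 0 ∧ c ≠ 0 ∧ c ^ 2 = s * y ∧ quadraticChar (ZMod p) (c ^ 2 - s * y) = 0 ∧
      evenTerm s c y = 0) ∨
    (s ≠ 0 ∧ c ^ 2 ≠ s * y ∧ quadraticChar (ZMod p) (c ^ 2 - s * y) = 1 ∧ evenTerm s c y = 1) ∨
    (s ≠ 0 ∧ c ^ 2 ≠ s * y ∧ quadraticChar (ZMod p) (c ^ 2 - s * y) = -1 ∧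
      evenTerm s c y = -1) := by
  by_cases hs : s = 0
  · by_cases hc : c = 0
    · simp [hs, hc, evenTerm, hy]
    · have h := quadraticChar_sq_one' hc
      simp only [hs, evenTerm, zero_mul, sub_zero, h, if_true, if_neg hc]
      simp [hc]
  · rcases quadraticChar_cases (c ^ 2 - s * y) with h | ⟨h, h'⟩ | ⟨h, h'⟩
    · have hc : c ≠ 0 := by
        rintro rfl
        simp [hs, hy] at h
      simp [evenTerm, hs, hc, sub_eq_zero.1 h]
    · simp [evenTerm, hs, h', sub_ne_zero.1 h]
    · simp [evenTerm, hs, h', sub_ne_zero.1 h]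

theorem evenTerm_swap {y : ZMod p} (hy : y ≠ 0) (s c : ZMod p) :
    evenTerm y c s = (quadraticChar (ZMod p) (c ^ 2 - s * y) : ℤ) := by
  rw [evenTerm, if_neg hy, mul_comm]

/-- The rank is even and positive, hence at least 2, and |e| = p^(-r/2). -/
theorem mul_formErr_sq_le (l u : ι → ZMod p) (hr : Even #{i | l i ≠ 0})
    (hu : ∃ i, l i ≠ 0 ∧ u i ≠ 0) : (formErr l * p) ^ 2 ≤ 1 := by
  have h := formErr_sq_mul l
  obtain ⟨i, hi, -⟩ := hu
  have h1 : 0 < #{i | l i ≠ 0} := Finset.card_pos.2 ⟨i, by simp [hi]⟩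
  obtain ⟨k, hk⟩ := hr
  rw [hk, show (k + k) / 2 = k by omega] at h
  have h2 : (p : ℚ) ^ 2 ≤ (p : ℚ) ^ (2 * k) :=
    pow_le_pow_right₀ (by exact_mod_cast (Fact.out : p.Prime).one_le) (by omega)
  rw [mul_pow, ← h]
  exact mul_le_mul_of_nonneg_left h2 (sq_nonneg _)

theorem card_quadric_compl (k : ℕ) : (p : ℚ) ^ ((k : ℤ) - 1) * (1 - (p : ℚ)⁻¹)
    = p ^ ((k : ℤ) - 2) * (p - 1) := by
  have h0 := cast_p_ne_zero (p := p)
  rw [cast_zpow_succ]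
  field_simp

theorem hasDiagDistribution_evenNe (hp : p ≠ 2) (l u : ι → ZMod p) (hr : Even #{i | l i ≠ 0})
    (hu : ∃ i, l i ≠ 0 ∧ u i ≠ 0) (hy : ∑ i, l i * u i ^ 2 ≠ 0)
    (hexc : (p : ℚ) - 1 - 2 * formErr l * p ≠ 0) :
    HasDiagDistribution l u
      (tableEvenNe p (Fintype.card ι : ℕ) (#{i | l i ≠ 0} : ℕ) (formErr l)) := by
  have h0 := cast_p_ne_zero (p := p)
  have h3 := three_le_cast hp
  have he := formErr_ne_zero l
  have he2 := mul_formErr_sq_le l u hr hu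
  obtain ⟨he3, he4⟩ := abs_le.1 ((sq_le_one_iff_abs_le_one _).1 he2)
  -- The constants come from p^(m-1)(1 - e) - p^(m-2)(1 + peE), with E the value of `evenTerm`.
  -- Solving for the weight p^(m-2)(p-1)(1-e) outside the image gives the artificial value E = -1/p.
  have key := hasDiagDistribution_affine (l := l) (u := u) (P := (p : ℚ) ^ ((Fintype.card ι : ℤ) - 2))
    (A := p - 1 - formErr l * p) (B := -(formErr l * p)) (w := -(p : ℚ)⁻¹)
    (g := fun s c => evenTerm s c (∑ i, l i * u i ^ 2))
    (M := fun s c => (p : ℚ) ^ ((#{i | l i ≠ 0} : ℤ) - 2)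
        * (1 + p * formErr l * evenTerm (∑ i, l i * u i ^ 2) c s))
    (cast_zpow_pos _).ne' (neg_ne_zero.2 (mul_ne_zero he h0)) ?_ ?_
    (card_image_fiber_even hp l u hr hu)
    [(-1, p ^ ((#{i | l i ≠ 0} : ℤ) - 2)
        + (p - 1) / 2 * p ^ ((#{i | l i ≠ 0} : ℤ) - 1) * (1 - formErr l * p) - 1),
      (0, (p - 1) * p ^ ((#{i | l i ≠ 0} : ℤ) - 2) * (2 + formErr l * p)),
      (1, (p - 1) * (p - 2) / 2 * p ^ ((#{i | l i ≠ 0} : ℤ) - 2) * (1 + formErr l * p)),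
      (-(p : ℚ)⁻¹, p ^ (Fintype.card ι : ℤ) - p ^ (#{i | l i ≠ 0} : ℤ))]
    ?_ (by simp) ?_ ?_
  · rw [tableEvenNe]
    convert key using 1
    refine cons_pair_congr rfl rfl (cons_pair_congr ?_ rfl (cons_pair_congr ?_ rfl
      (cons_pair_congr ?_ rfl (cons_pair_congr ?_ rfl rfl))))
    · ring
    · ring
    · ring
    · field_simp; ring
  · intro b hb
    rw [diagWeight_of_not_mem hp l u b hb, card_quadric_even hp l hr, if_neg hy]
    rw [mul_right_comm, card_quadric_compl, mul_assoc]
    congr 1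
    field_simp
    ring
  · intro b hb0 hb
    rw [diagWeight_eq, card_quadric_even hp l hr, card_section_even hp l b hr hb0 hb, if_neg hy,
      cast_zpow_succ]
    ring
  · simp only [List.forall_mem_cons, List.not_mem_nil, false_imp_iff, implies_true, and_true]
    refine ⟨?_, ?_, ?_, ?_⟩
    · intro h; linarith
    · intro h; linarith
    · intro h; exact hexc (by linarith)
    · intro h
      have h1 : (p : ℚ) - 1 - formErr l * p + formErr l = 0 := by
        rw [← h]; field_simp
      nlinarith
  · intro s c
    have h := evenTerm_cases hy s c
    generalize evenTerm s c _ = x at h ⊢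
    rcases h with h | h | h | h | h <;> simp [h]
  -- The value -1/p is never attained by `evenTerm`, so the last row consists of the vectors outside
  -- the image only.
  · have hneg : ∀ s c, evenTerm s c (∑ i, l i * u i ^ 2) ≠ -(p : ℚ)⁻¹ := by
      have h5 : (p : ℚ)⁻¹ ≠ 1 := by
        intro h; rw [inv_eq_one] at h; linarith
      have h6 : (0 : ℚ) < (p : ℚ)⁻¹ := by positivity
      intro s c h
      have hx := evenTerm_cases hy s c
      rw [h] at hx
      rcases hx with hx | hx | hx | hx | hx
      · exact h5 (by linarith [hx.2.2.2.2])
      · linarith [hx.2.2.2.2]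
      · linarith [hx.2.2.2.2]
      · linarith [hx.2.2.2]
      · exact h5 (by linarith [hx.2.2.2])
    have h00 : evenTerm 0 0 (∑ i, l i * u i ^ 2) = -1 := by simp [evenTerm, hy]
    have hp1 : -(p : ℚ)⁻¹ ≠ -1 := by rw [← h00]; exact (hneg 0 0).symm
    have hp2 : -(p : ℚ)⁻¹ ≠ 1 := by
      have h6 : (0 : ℚ) < (p : ℚ)⁻¹ := by positivity
      intro h; linarith
    generalize hyy : ∑ i, l i * u i ^ 2 = y at *
    simp only [List.forall_mem_cons, List.not_mem_nil, false_imp_iff, implies_true, and_true]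
    rw [cast_zpow_succ, h00]
    set R := (p : ℚ) ^ ((#{i | l i ≠ 0} : ℤ) - 2) with hR
    refine ⟨?_, ?_, ?_, ?_⟩
    -- Value -1 arises from nonresidue discriminants c² - sy and from the class (0, 0), whose
    -- discriminant is 0.
    · rw [sum_sum_eq_add (R * (1 - p * formErr l)) R
        (h₁ := fun s c => if quadraticChar (ZMod p) (c ^ 2 - s * y) = -1 then 1 else 0)
        (h₂ := fun s c => if s = 0 ∧ c = 0 then 1 else 0) (fun s c => ?_)
        (sum_disc_eq_neg_one hp hy) sum_zero_zero]
      · rw [if_pos rfl, if_neg hp1]; ring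
      · have h := evenTerm_cases hy s c
        rw [evenTerm_swap hy]
        generalize evenTerm s c y = x at h ⊢
        generalize quadraticChar (ZMod p) (c ^ 2 - s * y) = k at h ⊢
        rcases h with h | h | h | h | h <;> norm_num [h]
        left; ring
    · rw [sum_sum_eq_add (R * (1 + p * formErr l)) R
        (h₁ := fun s c => if s = 0 ∧ c ≠ 0 then 1 else 0)
        (h₂ := fun s c => if c ^ 2 = s * y ∧ c ≠ 0 then 1 else 0) (fun s c => ?_)
        sum_zero_ne_zero (sum_indicator_disc_zero hy)]
      · rw [if_neg (by norm_num), if_neg (by simpa using h0)]; ring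
      · have h := evenTerm_cases hy s c
        rw [evenTerm_swap hy]
        generalize evenTerm s c y = x at h ⊢
        generalize quadraticChar (ZMod p) (c ^ 2 - s * y) = k at h ⊢
        rcases h with h | h | h | h | h <;> norm_num [h]
    -- Value 1 needs a nonzero square discriminant with s ≠ 0; the pairs s = 0, c ≠ 0 also have a
    -- square discriminant and are removed.
    · rw [sum_sum_eq_add (R * (1 + p * formErr l)) (-(R * (1 + p * formErr l)))
        (h₁ := fun s c => if quadraticChar (ZMod p) (c ^ 2 - s * y) = 1 then 1 else 0)
        (h₂ := fun s c => if s = 0 ∧ c ≠ 0 then 1 else 0) (fun s c => ?_)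
        (sum_disc_eq_one hp hy) sum_zero_ne_zero]
      · rw [if_neg (by norm_num), if_neg hp2]; ring
      · have h := evenTerm_cases hy s c
        rw [evenTerm_swap hy]
        generalize evenTerm s c y = x at h ⊢
        generalize quadraticChar (ZMod p) (c ^ 2 - s * y) = k at h ⊢
        rcases h with h | h | h | h | h <;> norm_num [h]
    · simp only [hneg, if_false, Finset.sum_const_zero, hp1.symm, if_true]
      simp

theorem evenTerm_zero_cases (s c : ZMod p) :
    (s = 0 ∧ c = 0 ∧ evenTerm s c 0 = (p : ℚ) - 1 ∧ evenTerm 0 c s = (p : ℚ) - 1) ∨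
    (s = 0 ∧ c ≠ 0 ∧ evenTerm s c 0 = 0 ∧ evenTerm 0 c s = 0) ∨
    (s ≠ 0 ∧ c = 0 ∧ evenTerm s c 0 = 0 ∧ evenTerm 0 c s = -1) ∨
    (s ≠ 0 ∧ c ≠ 0 ∧ evenTerm s c 0 = 1 ∧ evenTerm 0 c s = 0) := by
  by_cases hs : s = 0
  · by_cases hc : c = 0 <;> simp [evenTerm, hs, hc]
  · by_cases hc : c = 0
    · simp [evenTerm, hs, hc]
    · have h := quadraticChar_sq_one' hc
      simp only [evenTerm, mul_zero, sub_zero, h, hs, if_true, if_neg hc, if_false]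
      simp [hs, hc]

theorem hasDiagDistribution_evenEq (hp : p ≠ 2) (l u : ι → ZMod p) (hr : Even #{i | l i ≠ 0})
    (hu : ∃ i, l i ≠ 0 ∧ u i ≠ 0) (hy : ∑ i, l i * u i ^ 2 = 0) :
    HasDiagDistribution l u
      (tableEvenEq p (Fintype.card ι : ℕ) (#{i | l i ≠ 0} : ℕ) (formErr l)) := by
  have h0 := cast_p_ne_zero (p := p)
  have h3 := three_le_cast hp
  have he := formErr_ne_zero l
  have hM := card_image_fiber_even hp l u hr hu
  rw [hy] at hM
  -- Positivity of the class (0, 0), which contains b = 0.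
  have hpos : 0 < 1 + formErr l * p * (p - 1) := by
    have h := image_fiber_zero_pos l u
    rw [hM, evenTerm, if_pos rfl, if_pos rfl, if_pos rfl] at h
    have := pos_of_mul_pos_right h (cast_zpow_pos _).le
    linarith
  have key := hasDiagDistribution_affine (l := l) (u := u)
    (P := (p : ℚ) ^ ((Fintype.card ι : ℤ) - 2))
    (A := p - 1 + formErr l * p * (p - 1)) (B := -(formErr l * p)) (w := (p - 1) / p)
    (g := fun s c => evenTerm s c 0)
    (M := fun s c => (p : ℚ) ^ ((#{i | l i ≠ 0} : ℤ) - 2)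
        * (1 + p * formErr l * evenTerm 0 c s))
    (cast_zpow_pos _).ne' (neg_ne_zero.2 (mul_ne_zero he h0)) ?_ ?_ hM
    [((p : ℚ) - 1, p ^ ((#{i | l i ≠ 0} : ℤ) - 2) * (1 + formErr l * (p - 1) * p) - 1),
      (0, (p - 1) * p ^ ((#{i | l i ≠ 0} : ℤ) - 2) * (2 - formErr l * p)),
      (1, (p - 1) ^ 2 * p ^ ((#{i | l i ≠ 0} : ℤ) - 2)),
      ((p - 1) / p, p ^ (Fintype.card ι : ℤ) - p ^ (#{i | l i ≠ 0} : ℤ))]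
    ?_ (by simp) ?_ ?_
  · rw [tableEvenEq]
    convert key using 1
    refine cons_pair_congr rfl rfl (cons_pair_congr ?_ rfl (cons_pair_congr ?_ rfl
      (cons_pair_congr ?_ rfl (cons_pair_congr ?_ rfl rfl))))
    · ring
    · ring
    · ring
    · field_simp; ring
  · intro b hb
    rw [diagWeight_of_not_mem hp l u b hb, card_quadric_even hp l hr, if_pos hy,
      mul_right_comm, card_quadric_compl, mul_assoc]
    congr 1
    field_simp
    ring
  · intro b hb0 hb
    rw [diagWeight_eq, card_quadric_even hp l hr, card_section_even hp l b hr hb0 hb, if_pos hy,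
      cast_zpow_succ, hy]
    ring
  · simp only [List.forall_mem_cons, List.not_mem_nil, false_imp_iff, implies_true, and_true]
    refine ⟨?_, ?_, ?_, ?_⟩
    · intro h; linarith
    · intro h; nlinarith
    · intro h; nlinarith
    · intro h
      have h1 : ((p : ℚ) - 1) * (p + (formErr l * p) * (p - 1)) = 0 := by
        have : (p : ℚ) * (p - 1 + formErr l * p * (p - 1) + -(formErr l * p) * ((p - 1) / p)) = 0 := by
          rw [h, mul_zero]
        rw [← this]; field_simp; ring
      rcases mul_eq_zero.1 h1 with h2 | h2 <;> linarith
  · intro s c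
    have h := evenTerm_zero_cases s c
    generalize evenTerm s c 0 = x at h ⊢
    rcases h with h | h | h | h <;> simp [h]
  · have h5 : ((p : ℚ) - 1) / p ≠ 1 := by
      intro h; rw [div_eq_iff h0] at h; linarith
    have h6 : ((p : ℚ) - 1) / p ≠ 0 := div_ne_zero (by linarith) h0
    have h7 : ((p : ℚ) - 1) / p ≠ p - 1 := by
      intro h; rw [div_eq_iff h0] at h; nlinarith
    have h8 : (p : ℚ) - 1 ≠ 0 := by linarith
    have h9 : (p : ℚ) - 1 ≠ 1 := by intro h; linarith
    have hneg : ∀ s c : ZMod p, evenTerm s c 0 ≠ ((p : ℚ) - 1) / p := by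
      intro s c h
      have hx := evenTerm_zero_cases s c
      rw [h] at hx
      rcases hx with hx | hx | hx | hx
      · exact h7 hx.2.2.1
      · exact h6 hx.2.2.1
      · exact h6 hx.2.2.1
      · exact h5 hx.2.2.1
    have h00 : evenTerm (0 : ZMod p) 0 0 = (p : ℚ) - 1 := by simp [evenTerm]
    simp only [List.forall_mem_cons, List.not_mem_nil, false_imp_iff, implies_true, and_true]
    rw [h00]
    set R := (p : ℚ) ^ ((#{i | l i ≠ 0} : ℤ) - 2) with hR
    refine ⟨?_, ?_, ?_, ?_⟩
    · rw [sum_sum_eq_mul (R * (1 + formErr l * p * (p - 1)))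
        (h := fun s c => if s = 0 ∧ c = 0 then 1 else 0) (fun s c => ?_) sum_zero_zero]
      · rw [if_pos rfl, if_neg h7]; ring
      · have h := evenTerm_zero_cases s c
        generalize evenTerm s c 0 = x0 at h ⊢
        generalize evenTerm 0 c s = x1 at h ⊢
        rcases h with h | h | h | h <;> norm_num [h, h8, h8.symm, h9, h9.symm]
        left; ring
    · rw [sum_sum_eq_add (R) (R * (1 - formErr l * p))
        (h₁ := fun s c => if s = 0 ∧ c ≠ 0 then 1 else 0)
        (h₂ := fun s c => if s ≠ 0 ∧ c = 0 then 1 else 0) (fun s c => ?_)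
        sum_zero_ne_zero sum_ne_zero_zero]
      · rw [if_neg h8, if_neg h6]; ring
      · have h := evenTerm_zero_cases s c
        generalize evenTerm s c 0 = x0 at h ⊢
        generalize evenTerm 0 c s = x1 at h ⊢
        rcases h with h | h | h | h <;> norm_num [h, h8, h8.symm, h9, h9.symm]
        left; ring
    · rw [sum_sum_eq_mul (R)
        (h := fun s c => if s ≠ 0 ∧ c ≠ 0 then 1 else 0) (fun s c => ?_) sum_ne_zero_ne_zero]
      · rw [if_neg h9, if_neg h5]; ring
      · have h := evenTerm_zero_cases s c
        generalize evenTerm s c 0 = x0 at h ⊢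
        generalize evenTerm 0 c s = x1 at h ⊢
        rcases h with h | h | h | h <;> norm_num [h, h8, h8.symm, h9, h9.symm]
    · simp only [hneg, if_false, Finset.sum_const_zero, h7.symm, if_true]
      simp

/-! ### The weight tables for odd rank -/

/-- Multiplying by η(-y) turns η(-s) into η(sy), matching the factor η(-y) absorbed into e; the
resulting values no longer depend on a choice of sign. -/
theorem oddTerm_cases {y : ZMod p} (hy : y ≠ 0) (s c : ZMod p) :
    (s = 0 ∧ c = 0 ∧ c ^ 2 = s * y ∧ quadraticChar (ZMod p) (s * y) = 0 ∧
      quadraticChar (ZMod p) (-y) * oddTerm s c y = p) ∨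
    (s = 0 ∧ c ≠ 0 ∧ c ^ 2 ≠ s * y ∧ quadraticChar (ZMod p) (s * y) = 0 ∧
      quadraticChar (ZMod p) (-y) * oddTerm s c y = 0) ∨
    (s ≠ 0 ∧ c ≠ 0 ∧ c ^ 2 = s * y ∧ quadraticChar (ZMod p) (s * y) = 1 ∧
      quadraticChar (ZMod p) (-y) * oddTerm s c y = (p : ℚ) - 1) ∨
    (s ≠ 0 ∧ c ^ 2 ≠ s * y ∧ quadraticChar (ZMod p) (s * y) = 1 ∧
      quadraticChar (ZMod p) (-y) * oddTerm s c y = -1) ∨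
    (s ≠ 0 ∧ c ^ 2 ≠ s * y ∧ quadraticChar (ZMod p) (s * y) = -1 ∧
      quadraticChar (ZMod p) (-y) * oddTerm s c y = 1) := by
  by_cases hs : s = 0
  · have h1 : ((quadraticChar (ZMod p) (-y) : ℤ) : ℚ) ^ 2 = 1 := by
      exact_mod_cast quadraticChar_sq_one (neg_ne_zero.2 hy)
    by_cases hc : c = 0
    · refine Or.inl ⟨hs, hc, by simp [hs, hc], by simp [hs], ?_⟩
      rw [oddTerm, if_pos hs, if_pos hc]
      linear_combination (p : ℚ) * h1
    · refine Or.inr (Or.inl ⟨hs, hc, by simp [hs, hc], by simp [hs], ?_⟩)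
      rw [oddTerm, if_pos hs, if_neg hc, mul_zero]
  · have h1 : ((quadraticChar (ZMod p) (-y) : ℤ) : ℚ) * quadraticChar (ZMod p) (-s)
        = quadraticChar (ZMod p) (s * y) := by
      rw [← neg_mul_neg s y, map_mul]; push_cast; ring
    have h2 : ((quadraticChar (ZMod p) (-y) : ℤ) : ℚ) * oddTerm s c y
        = quadraticChar (ZMod p) (s * y) * ((if c ^ 2 = s * y then (p : ℚ) else 0) - 1) := by
      rw [oddTerm, if_neg hs, ← mul_assoc, h1]
    rw [h2]
    by_cases hd : c ^ 2 = s * y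
    · have hc : c ≠ 0 := by
        rintro rfl
        exact mul_ne_zero hs hy (by rw [← hd]; simp)
      have h3 : quadraticChar (ZMod p) (s * y) = 1 := by
        rw [← hd]; exact quadraticChar_sq_one' hc
      exact Or.inr (Or.inr (Or.inl ⟨hs, hc, hd, h3, by rw [h3, if_pos hd]; simp⟩))
    · rcases quadraticChar_dichotomy (mul_ne_zero hs hy) with h | h
      · exact Or.inr (Or.inr (Or.inr (Or.inl ⟨hs, hd, h, by rw [h, if_neg hd]; simp⟩)))
      · exact Or.inr (Or.inr (Or.inr (Or.inr ⟨hs, hd, h, by rw [h, if_neg hd]; simp⟩)))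

theorem hasDiagDistribution_oddNe (hp : p ≠ 2) (l u : ι → ZMod p) (hr : Odd #{i | l i ≠ 0})
    (hu : ∃ i, l i ≠ 0 ∧ u i ≠ 0) {y : ZMod p} (hyu : ∑ i, l i * u i ^ 2 = y) (hy : y ≠ 0) :
    HasDiagDistribution l u
      (tableOddNe p (Fintype.card ι : ℕ) (#{i | l i ≠ 0} : ℕ)
        (formErr l * quadraticChar (ZMod p) (-y))) := by
  have h3 := three_le_cast hp
  have hη : ((quadraticChar (ZMod p) (-y) : ℤ) : ℚ) ^ 2 = 1 := by
    exact_mod_cast quadraticChar_sq_one (neg_ne_zero.2 hy)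
  have hη0 : ((quadraticChar (ZMod p) (-y) : ℤ) : ℚ) ≠ 0 := by
    intro h; rw [h] at hη; norm_num at hη
  obtain ⟨e, he⟩ : ∃ e, e = formErr l * quadraticChar (ZMod p) (-y) := ⟨_, rfl⟩
  have he0 : e ≠ 0 := by rw [he]; exact mul_ne_zero (formErr_ne_zero l) hη0
  have hef : formErr l = e * quadraticChar (ZMod p) (-y) := by
    rw [he, mul_assoc, ← pow_two, hη, mul_one]
  have hM : ∀ s c, (#{b : ι → ZMod p | (∀ i, l i = 0 → b i = 0) ∧ ∑ i, (l i)⁻¹ * b i ^ 2 = s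
        ∧ ∑ i, b i * u i = c} : ℚ) = (p : ℚ) ^ ((#{i | l i ≠ 0} : ℤ) - 2)
          * (1 + e * ((if c ^ 2 = s * y then (p : ℚ) else 0) - 1)) := by
    intro s c
    rw [card_image_fiber_odd hp l u hr hu, hyu, oddTerm, if_neg hy, he, mul_comm y s, mul_assoc]
  rw [← he]
  have hpos : 0 < 1 + e * (p - 1) := by
    have h := image_fiber_zero_pos l u
    rw [hM, if_pos (by simp)] at h
    exact pos_of_mul_pos_right h (cast_zpow_pos _).le
  -- Here `w = 1` is also a value of the deviation: the vectors outside the image share their weight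
  -- with the classes in which sy is a nonresidue, and the last row adds the two counts.
  have key := hasDiagDistribution_affine (l := l) (u := u)
    (P := (p : ℚ) ^ ((Fintype.card ι : ℤ) - 2))
    (A := p - 1 + e * p) (B := -e) (w := 1)
    (g := fun s c => quadraticChar (ZMod p) (-y) * oddTerm s c y)
    (cast_zpow_pos _).ne' (neg_ne_zero.2 he0) ?_ ?_ hM
    [((p : ℚ), p ^ ((#{i | l i ≠ 0} : ℤ) - 2) * (1 + e * (p - 1)) - 1),
      (0, (p - 1) * p ^ ((#{i | l i ≠ 0} : ℤ) - 2) * (1 - e)),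
      ((p : ℚ) - 1, (p - 1) * p ^ ((#{i | l i ≠ 0} : ℤ) - 2) * (1 + e * (p - 1))),
      (-1, (p - 1) * (p - 2) / 2 * p ^ ((#{i | l i ≠ 0} : ℤ) - 2) * (1 - e)),
      (1, (p - 1) / 2 * p ^ ((#{i | l i ≠ 0} : ℤ) - 1) * (1 - e)
        + p ^ (Fintype.card ι : ℤ) - p ^ (#{i | l i ≠ 0} : ℤ))]
    ?_ (by simp) ?_ ?_
  · rw [tableOddNe]
    convert key using 1
    refine cons_pair_congr rfl rfl (cons_pair_congr ?_ rfl (cons_pair_congr ?_ rfl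
      (cons_pair_congr ?_ rfl (cons_pair_congr ?_ rfl (cons_pair_congr ?_ rfl rfl))))) <;> ring
  · intro b hb
    rw [diagWeight_of_not_mem hp l u b hb, card_quadric_odd hp l hr, hyu, ← he,
      mul_right_comm, card_quadric_compl, mul_assoc]
    congr 1
    ring
  · intro b hb0 hb
    rw [diagWeight_eq, card_quadric_odd hp l hr, card_section_odd hp l b hr hb0 hb,
      cast_zpow_succ, hyu, ← he, hef]
    ring
  · simp only [List.forall_mem_cons, List.not_mem_nil, false_imp_iff, implies_true, and_true]
    refine ⟨?_, ?_, ?_, ?_, ?_⟩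
    · intro h; linarith
    · intro h; nlinarith
    · intro h; nlinarith
    · intro h; nlinarith
    · intro h; nlinarith
  · intro s c
    have h := oddTerm_cases hy s c
    generalize (quadraticChar (ZMod p) (-y) : ℚ) * oddTerm s c y = x at h ⊢
    rcases h with h | h | h | h | h <;> simp [h]
  · have h00 : (quadraticChar (ZMod p) (-y) : ℚ) * oddTerm 0 0 y = p := by
      rw [oddTerm, if_pos rfl, if_pos rfl]
      linear_combination (p : ℚ) * hη
    have n0 : (p : ℚ) ≠ 0 := by linarith
    have hn : p ≠ 1 := (Fact.out : p.Prime).ne_one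
    have n1 : (p : ℚ) ≠ 1 := by linarith
    have n2 : (p : ℚ) ≠ -1 := by intro h; linarith
    have n3 : (p : ℚ) ≠ p - 1 := by intro h; linarith
    have n4 : (p : ℚ) - 1 ≠ 0 := by linarith
    have n5 : (p : ℚ) - 1 ≠ 1 := by intro h; linarith
    have n6 : (p : ℚ) - 1 ≠ -1 := by intro h; linarith
    simp only [List.forall_mem_cons, List.not_mem_nil, false_imp_iff, implies_true, and_true]
    rw [h00, cast_zpow_succ]
    set R := (p : ℚ) ^ ((#{i | l i ≠ 0} : ℤ) - 2) with hR
    refine ⟨?_, ?_, ?_, ?_, ?_⟩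
    · rw [sum_sum_eq_mul (R * (1 + e * (p - 1)))
        (h := fun s c => if s = 0 ∧ c = 0 then 1 else 0) (fun s c => ?_) sum_zero_zero]
      · rw [if_pos rfl, if_neg n1.symm]; ring
      · have h := oddTerm_cases hy s c
        generalize (quadraticChar (ZMod p) (-y) : ℚ) * oddTerm s c y = x0 at h ⊢
        generalize quadraticChar (ZMod p) (s * y) = x1 at h ⊢
        rcases h with h | h | h | h | h <;> norm_num [h, hn, n0, n0.symm, n1, n1.symm, n2, n2.symm, n3, n3.symm, n4, n4.symm, n5, n5.symm, n6, n6.symm]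
    · rw [sum_sum_eq_mul (R * (1 - e))
        (h := fun s c => if s = 0 ∧ c ≠ 0 then 1 else 0) (fun s c => ?_) sum_zero_ne_zero]
      · rw [if_neg n0, if_neg one_ne_zero]; ring
      · have h := oddTerm_cases hy s c
        generalize (quadraticChar (ZMod p) (-y) : ℚ) * oddTerm s c y = x0 at h ⊢
        generalize quadraticChar (ZMod p) (s * y) = x1 at h ⊢
        rcases h with h | h | h | h | h <;> norm_num [h, hn, n0, n0.symm, n1, n1.symm, n2, n2.symm, n3, n3.symm, n4, n4.symm, n5, n5.symm, n6, n6.symm]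
        left; ring
    · rw [sum_sum_eq_mul (R * (1 + e * (p - 1)))
        (h := fun s c => if c ^ 2 = s * y ∧ c ≠ 0 then 1 else 0) (fun s c => ?_) (sum_indicator_disc_zero hy)]
      · rw [if_neg n3, if_neg n5.symm]; ring
      · have h := oddTerm_cases hy s c
        generalize (quadraticChar (ZMod p) (-y) : ℚ) * oddTerm s c y = x0 at h ⊢
        generalize quadraticChar (ZMod p) (s * y) = x1 at h ⊢
        rcases h with h | h | h | h | h <;> norm_num [h, hn, n0, n0.symm, n1, n1.symm, n2, n2.symm, n3, n3.symm, n4, n4.symm, n5, n5.symm, n6, n6.symm]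
    · rw [sum_sum_eq_add (R * (1 - e)) (-(R * (1 - e)))
        (h₁ := fun s c => if quadraticChar (ZMod p) (s * y) = 1 then 1 else 0)
        (h₂ := fun s c => if c ^ 2 = s * y ∧ c ≠ 0 then 1 else 0) (fun s c => ?_)
        (sum_mul_eq_one hp hy) (sum_indicator_disc_zero hy)]
      · rw [if_neg n2, if_neg (by norm_num)]; ring
      · have h := oddTerm_cases hy s c
        generalize (quadraticChar (ZMod p) (-y) : ℚ) * oddTerm s c y = x0 at h ⊢
        generalize quadraticChar (ZMod p) (s * y) = x1 at h ⊢
        rcases h with h | h | h | h | h <;> norm_num [h, hn, n0, n0.symm, n1, n1.symm, n2, n2.symm, n3, n3.symm, n4, n4.symm, n5, n5.symm, n6, n6.symm]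
        left; ring
    · rw [sum_sum_eq_mul (R * (1 - e))
        (h := fun s c => if quadraticChar (ZMod p) (s * y) = -1 then 1 else 0) (fun s c => ?_) (sum_mul_eq_neg_one hp hy)]
      · rw [if_neg n1, if_pos trivial, zpow_natCast, zpow_natCast]; ring
      · have h := oddTerm_cases hy s c
        generalize (quadraticChar (ZMod p) (-y) : ℚ) * oddTerm s c y = x0 at h ⊢
        generalize quadraticChar (ZMod p) (s * y) = x1 at h ⊢
        rcases h with h | h | h | h | h <;> norm_num [h, hn, n0, n0.symm, n1, n1.symm, n2, n2.symm, n3, n3.symm, n4, n4.symm, n5, n5.symm, n6, n6.symm]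
        left; ring

theorem oddTerm_zero_cases (s c : ZMod p) :
    (s = 0 ∧ quadraticChar (ZMod p) (-s) = 0 ∧ oddTerm s c 0 = 0 ∧ oddTerm 0 c s = 0) ∨
    (s ≠ 0 ∧ c = 0 ∧ quadraticChar (ZMod p) (-s) = 1 ∧ oddTerm s c 0 = (p : ℚ) - 1 ∧
      oddTerm 0 c s = p) ∨
    (s ≠ 0 ∧ c = 0 ∧ quadraticChar (ZMod p) (-s) = -1 ∧ oddTerm s c 0 = 1 - (p : ℚ) ∧
      oddTerm 0 c s = -p) ∨
    (s ≠ 0 ∧ c ≠ 0 ∧ quadraticChar (ZMod p) (-s) = 1 ∧ oddTerm s c 0 = -1 ∧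
      oddTerm 0 c s = 0) ∨
    (s ≠ 0 ∧ c ≠ 0 ∧ quadraticChar (ZMod p) (-s) = -1 ∧ oddTerm s c 0 = 1 ∧
      oddTerm 0 c s = 0) := by
  rw [oddTerm, oddTerm, if_pos rfl]
  by_cases hs : s = 0
  · simp [hs]
  · rcases quadraticChar_dichotomy (neg_ne_zero.2 hs) with h | h <;> rw [h] <;>
      by_cases hc : c = 0 <;> simp [hs, hc]

theorem sum_neg_eq_one_and_zero (hp : p ≠ 2) :
    ∑ s : ZMod p, ∑ c : ZMod p,
      (if quadraticChar (ZMod p) (-s) = 1 ∧ c = 0 then (1 : ℚ) else 0)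
        = (p - 1) / 2 := by
  rw [sum_indicator_and (fun s => quadraticChar (ZMod p) (-s) = 1) fun c => c = 0,
    sum_quadraticChar_neg_eq_one hp]
  simp

theorem sum_neg_eq_one_and_ne_zero (hp : p ≠ 2) :
    ∑ s : ZMod p, ∑ c : ZMod p,
      (if quadraticChar (ZMod p) (-s) = 1 ∧ c ≠ 0 then (1 : ℚ) else 0)
        = (p - 1) ^ 2 / 2 := by
  rw [sum_indicator_and (fun s => quadraticChar (ZMod p) (-s) = 1) fun c => c ≠ 0,
    sum_quadraticChar_neg_eq_one hp, sum_indicator_ne_zero]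
  ring

theorem sum_neg_eq_neg_one_and_zero (hp : p ≠ 2) :
    ∑ s : ZMod p, ∑ c : ZMod p,
      (if quadraticChar (ZMod p) (-s) = -1 ∧ c = 0 then (1 : ℚ) else 0)
        = (p - 1) / 2 := by
  rw [sum_indicator_and (fun s => quadraticChar (ZMod p) (-s) = -1) fun c => c = 0,
    sum_quadraticChar_neg_eq_neg_one hp]
  simp

theorem sum_neg_eq_neg_one_and_ne_zero (hp : p ≠ 2) :
    ∑ s : ZMod p, ∑ c : ZMod p,
      (if quadraticChar (ZMod p) (-s) = -1 ∧ c ≠ 0 then (1 : ℚ) else 0)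
        = (p - 1) ^ 2 / 2 := by
  rw [sum_indicator_and (fun s => quadraticChar (ZMod p) (-s) = -1) fun c => c ≠ 0,
    sum_quadraticChar_neg_eq_neg_one hp, sum_indicator_ne_zero]
  ring

theorem sum_zero_left :
    ∑ s : ZMod p, ∑ _c : ZMod p, (if s = 0 then (1 : ℚ) else 0) = p := by
  rw [Finset.sum_comm]
  simp [ZMod.card]

theorem hasDiagDistribution_oddEq (hp : p ≠ 2) (l u : ι → ZMod p) (hr : Odd #{i | l i ≠ 0})
    (hu : ∃ i, l i ≠ 0 ∧ u i ≠ 0) (hy : ∑ i, l i * u i ^ 2 = 0) :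
    HasDiagDistribution l u
      (tableOddEq p (Fintype.card ι : ℕ) (#{i | l i ≠ 0} : ℕ) (formErr l)) := by
  have h3 := three_le_cast hp
  have he0 := formErr_ne_zero l
  have hM := card_image_fiber_odd hp l u hr hu
  rw [hy] at hM
  -- For rank 1 the class (0, 0) would have size 1/p, although it contains b = 0. Hence r ≥ 3 and
  -- |e| < 1, so the weights with factors 1 ± e do not vanish.
  have hr1 : #{i | l i ≠ 0} ≠ 1 := by
    intro h1
    have h := image_fiber_zero_pos l u
    have h' := hM 0 0
    rw [oddTerm, if_pos rfl, if_pos rfl, h1] at h'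
    rw [Nat.cast_pos] at h
    have h2 : (1 : ℚ) ≤ #{b : ι → ZMod p | (∀ i, l i = 0 → b i = 0)
        ∧ ∑ i, (l i)⁻¹ * b i ^ 2 = 0 ∧ ∑ i, b i * u i = 0} := by exact_mod_cast h
    rw [h'] at h2
    norm_num at h2
    have : (p : ℚ)⁻¹ < 1 := inv_lt_one_of_one_lt₀ (by linarith)
    linarith
  have he2 : (formErr l) ^ 2 < 1 := by
    have h := formErr_sq_mul l
    have h1 : 1 < (p : ℚ) ^ (2 * (#{i | l i ≠ 0} / 2)) := by
      apply one_lt_pow₀ (by linarith)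
      obtain ⟨k, hk⟩ := hr
      omega
    have h4 : 0 < formErr l ^ 2 := by positivity
    nlinarith
  obtain ⟨he3, he4⟩ := abs_lt.1 ((sq_lt_one_iff_abs_lt_one _).1 he2)
  have key := hasDiagDistribution_affine (l := l) (u := u)
    (P := (p : ℚ) ^ ((Fintype.card ι : ℤ) - 2))
    (A := p - 1) (B := -formErr l) (w := 0)
    (g := fun s c => oddTerm s c 0)
    (M := fun s c => (p : ℚ) ^ ((#{i | l i ≠ 0} : ℤ) - 2)
        * (1 + formErr l * oddTerm 0 c s))
    (cast_zpow_pos _).ne' (neg_ne_zero.2 he0) ?_ ?_ hM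
    [((p : ℚ) - 1, (p - 1) / 2 * p ^ ((#{i | l i ≠ 0} : ℤ) - 2) * (1 + formErr l * p)),
      (1 - (p : ℚ), (p - 1) / 2 * p ^ ((#{i | l i ≠ 0} : ℤ) - 2) * (1 - formErr l * p)),
      (-1, (p - 1) ^ 2 / 2 * p ^ ((#{i | l i ≠ 0} : ℤ) - 2)),
      (1, (p - 1) ^ 2 / 2 * p ^ ((#{i | l i ≠ 0} : ℤ) - 2)),
      (0, p ^ ((#{i | l i ≠ 0} : ℤ) - 1)
        + p ^ (Fintype.card ι : ℤ) - p ^ (#{i | l i ≠ 0} : ℤ) - 1)]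
    ?_ (by simp) ?_ ?_
  · rw [tableOddEq]
    convert key using 1
    refine cons_pair_congr rfl rfl (cons_pair_congr ?_ rfl (cons_pair_congr ?_ rfl
      (cons_pair_congr ?_ rfl (cons_pair_congr ?_ rfl (cons_pair_congr ?_ rfl rfl))))) <;> ring
  · intro b hb
    rw [diagWeight_of_not_mem hp l u b hb, card_quadric_odd hp l hr, hy,
      mul_right_comm, card_quadric_compl, mul_assoc]
    simp
  · intro b hb0 hb
    rw [diagWeight_eq, card_quadric_odd hp l hr, card_section_odd hp l b hr hb0 hb,
      cast_zpow_succ, hy, neg_zero, quadraticChar_zero]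
    push_cast
    ring
  · simp only [List.forall_mem_cons, List.not_mem_nil, false_imp_iff, implies_true, and_true]
    refine ⟨?_, ?_, ?_, ?_, ?_⟩
    · intro h; nlinarith
    · intro h; nlinarith
    · intro h; linarith
    · intro h; linarith
    · intro h; linarith
  · intro s c
    have h := oddTerm_zero_cases s c
    generalize oddTerm s c 0 = x at h ⊢
    rcases h with h | h | h | h | h <;> simp [h]
  · have h00 : oddTerm (0 : ZMod p) 0 0 = 0 := by simp [oddTerm]
    have n1 : (p : ℚ) - 1 ≠ 1 - p := by intro h; linarith
    have n2 : (p : ℚ) - 1 ≠ -1 := by intro h; linarith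
    have n3 : (p : ℚ) - 1 ≠ 1 := by intro h; linarith
    have n4 : (p : ℚ) - 1 ≠ 0 := by linarith
    have n5 : 1 - (p : ℚ) ≠ -1 := by intro h; linarith
    have n6 : 1 - (p : ℚ) ≠ 1 := by intro h; linarith
    have n7 : 1 - (p : ℚ) ≠ 0 := by intro h; linarith
    simp only [List.forall_mem_cons, List.not_mem_nil, false_imp_iff, implies_true, and_true]
    rw [h00, cast_zpow_succ]
    set R := (p : ℚ) ^ ((#{i | l i ≠ 0} : ℤ) - 2) with hR
    refine ⟨?_, ?_, ?_, ?_, ?_⟩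
    · rw [sum_sum_eq_mul (R * (1 + formErr l * p))
        (h := fun s c => if quadraticChar (ZMod p) (-s) = 1 ∧ c = 0 then 1 else 0) (fun s c => ?_) (sum_neg_eq_one_and_zero hp)]
      · rw [if_neg n4.symm, if_neg n4.symm]; ring
      · have h := oddTerm_zero_cases s c
        generalize oddTerm s c 0 = x0 at h ⊢
        generalize oddTerm 0 c s = x1 at h ⊢
        generalize quadraticChar (ZMod p) (-s) = x2 at h ⊢
        rcases h with h | h | h | h | h <;> norm_num [h, n1, n1.symm, n2, n2.symm, n3, n3.symm, n4, n4.symm, n5, n5.symm, n6, n6.symm, n7, n7.symm]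
    · rw [sum_sum_eq_mul (R * (1 - formErr l * p))
        (h := fun s c => if quadraticChar (ZMod p) (-s) = -1 ∧ c = 0 then 1 else 0) (fun s c => ?_) (sum_neg_eq_neg_one_and_zero hp)]
      · rw [if_neg n7.symm, if_neg n7.symm]; ring
      · have h := oddTerm_zero_cases s c
        generalize oddTerm s c 0 = x0 at h ⊢
        generalize oddTerm 0 c s = x1 at h ⊢
        generalize quadraticChar (ZMod p) (-s) = x2 at h ⊢
        rcases h with h | h | h | h | h <;> norm_num [h, n1, n1.symm, n2, n2.symm, n3, n3.symm, n4, n4.symm, n5, n5.symm, n6, n6.symm, n7, n7.symm]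
        left; ring
    · rw [sum_sum_eq_mul (R)
        (h := fun s c => if quadraticChar (ZMod p) (-s) = 1 ∧ c ≠ 0 then 1 else 0) (fun s c => ?_) (sum_neg_eq_one_and_ne_zero hp)]
      · norm_num; ring
      · have h := oddTerm_zero_cases s c
        generalize oddTerm s c 0 = x0 at h ⊢
        generalize oddTerm 0 c s = x1 at h ⊢
        generalize quadraticChar (ZMod p) (-s) = x2 at h ⊢
        rcases h with h | h | h | h | h <;> norm_num [h, n1, n1.symm, n2, n2.symm, n3, n3.symm, n4, n4.symm, n5, n5.symm, n6, n6.symm, n7, n7.symm]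
    · rw [sum_sum_eq_mul (R)
        (h := fun s c => if quadraticChar (ZMod p) (-s) = -1 ∧ c ≠ 0 then 1 else 0) (fun s c => ?_) (sum_neg_eq_neg_one_and_ne_zero hp)]
      · norm_num; ring
      · have h := oddTerm_zero_cases s c
        generalize oddTerm s c 0 = x0 at h ⊢
        generalize oddTerm 0 c s = x1 at h ⊢
        generalize quadraticChar (ZMod p) (-s) = x2 at h ⊢
        rcases h with h | h | h | h | h <;> norm_num [h, n1, n1.symm, n2, n2.symm, n3, n3.symm, n4, n4.symm, n5, n5.symm, n6, n6.symm, n7, n7.symm]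
    -- All pairs with s = 0 have deviation 0, the value shared by the vectors outside the image; b =
    -- 0 is among them and is subtracted.
    · rw [sum_sum_eq_mul (R)
        (h := fun s c => if s = 0 then 1 else 0) (fun s c => ?_) sum_zero_left]
      · rw [if_pos rfl, if_pos trivial, zpow_natCast, zpow_natCast]; ring
      · have h := oddTerm_zero_cases s c
        generalize oddTerm s c 0 = x0 at h ⊢
        generalize oddTerm 0 c s = x1 at h ⊢
        generalize quadraticChar (ZMod p) (-s) = x2 at h ⊢
        rcases h with h | h | h | h | h <;> norm_num [h, n1, n1.symm, n2, n2.symm, n3, n3.symm, n4, n4.symm, n5, n5.symm, n6, n6.symm, n7, n7.symm]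

end QuadCode

/-! ### The trace form: from GF(q) to diagonal coordinates -/

namespace QuadCode

open Finset

section Field

variable {p : ℕ} [Fact p.Prime] {K : Type*} [Field K] [Algebra (ZMod p) K] {m : ℕ}

theorem Tr_add (x y : K) : Tr (p := p) (x + y) = Tr (p := p) x + Tr (p := p) y :=
  map_add _ x y

theorem Tr_smul (c : ZMod p) (x : K) : Tr (p := p) (c • x) = c * Tr (p := p) x :=
  map_smul (Algebra.trace (ZMod p) K) c x

theorem charP_of_algebra_zmod (p : ℕ) [Fact p.Prime] (K : Type*) [Field K] [Algebra (ZMod p) K] :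
    CharP K p :=
  charP_of_injective_algebraMap (algebraMap (ZMod p) K).injective p

theorem add_pow_prime_pow (x y : K) (i : ℕ) :
    (x + y) ^ p ^ i = x ^ p ^ i + y ^ p ^ i := by
  have := charP_of_algebra_zmod p K
  exact add_pow_char_pow x y p i

theorem smul_pow_prime_pow (c : ZMod p) (x : K) (i : ℕ) :
    (c • x) ^ p ^ i = c • x ^ p ^ i := by
  rw [smul_pow, ZMod.pow_card_pow]

theorem Tr_pow [Finite K] (x : K) (i : ℕ) : Tr (p := p) (x ^ p ^ i) = Tr (p := p) x := by
  induction i with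
  | zero => simp
  | succ i ih =>
    rw [← ih, pow_succ, pow_mul]
    have h := Algebra.trace_eq_of_algEquiv (FiniteField.frobeniusAlgEquivOfAlgebraic (ZMod p) K)
      (x ^ p ^ i)
    rw [FiniteField.coe_frobeniusAlgEquivOfAlgebraic, ZMod.card] at h
    exact h

variable (p) in
/-- The symmetric bilinear form of the quadratic function `quadFun a`. -/
def polarForm (a : Fin m → K) : LinearMap.BilinForm (ZMod p) K :=
  LinearMap.mk₂ (ZMod p)
    (fun x z => 2⁻¹ * ∑ i : Fin m, Tr (p := p) (a i * (x ^ p ^ (i : ℕ) * z + x * z ^ p ^ (i : ℕ))))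
    (fun x y z => by
      rw [← mul_add, ← Finset.sum_add_distrib]
      congr 1
      refine Finset.sum_congr rfl fun i _ => ?_
      rw [← Tr_add, add_pow_prime_pow]
      congr 1; ring)
    (fun c x z => by
      rw [smul_eq_mul, mul_left_comm c, Finset.mul_sum _ _ c]
      congr 1
      refine Finset.sum_congr rfl fun i _ => ?_
      rw [← Tr_smul c, smul_pow_prime_pow]
      simp only [smul_mul_assoc, ← smul_add, mul_smul_comm])
    (fun x y z => by
      rw [← mul_add, ← Finset.sum_add_distrib]
      congr 1
      refine Finset.sum_congr rfl fun i _ => ?_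
      rw [← Tr_add, add_pow_prime_pow]
      congr 1; ring)
    (fun c x z => by
      rw [smul_eq_mul, mul_left_comm c, Finset.mul_sum _ _ c]
      congr 1
      refine Finset.sum_congr rfl fun i _ => ?_
      rw [← Tr_smul c, smul_pow_prime_pow]
      simp only [mul_smul_comm, ← smul_add])

theorem polarForm_apply (a : Fin m → K) (x z : K) :
    polarForm p a x z
      = 2⁻¹ * ∑ i : Fin m, Tr (p := p) (a i * (x ^ p ^ (i : ℕ) * z + x * z ^ p ^ (i : ℕ))) := rfl

theorem polarForm_comm (a : Fin m → K) (x z : K) : polarForm p a x z = polarForm p a z x := by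
  rw [polarForm_apply, polarForm_apply]
  congr 1
  refine Finset.sum_congr rfl fun i _ => ?_
  congr 1; ring

theorem polarForm_self (hp : p ≠ 2) (a : Fin m → K) (x : K) :
    polarForm p a x x = quadFun (p := p) a x := by
  rw [polarForm_apply, quadFun, Finset.mul_sum]
  refine Finset.sum_congr rfl fun i _ => ?_
  have h : a i * (x ^ p ^ (i : ℕ) * x + x * x ^ p ^ (i : ℕ))
      = (2 : ZMod p) • (a i * x ^ (p ^ (i : ℕ) + 1)) := by
    rw [two_smul, pow_succ]; ring
  rw [h, Tr_smul, inv_mul_cancel_left₀ (two_ne_zero_zmod hp)]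

theorem toMatrix_polarForm (a : Fin m → K) (v : Module.Basis (Fin m) (ZMod p) K) :
    LinearMap.BilinForm.toMatrix v (polarForm p a) = quadMatrix a v := by
  ext j k
  rw [LinearMap.BilinForm.toMatrix_apply]
  rfl

/-- The trace is invariant under the Frobenius power x ↦ x^(p^i), and w^(p^m) = w. The index 0 is
separate, since it is its own negative. -/
theorem Tr_mul_pow_neg [Finite K] (hK : Nat.card K = p ^ m) (i : Fin m) (x w : K) :
    Tr (p := p) (x * w ^ p ^ ((-i : Fin m) : ℕ)) = Tr (p := p) (x ^ p ^ (i : ℕ) * w) := by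
  rw [← Tr_pow (x * w ^ p ^ ((-i : Fin m) : ℕ)) (i : ℕ), mul_pow, ← pow_mul, ← pow_add]
  congr 2
  rw [Fin.val_neg']
  rcases Nat.eq_zero_or_pos (i : ℕ) with h | h
  · simp [h]
  · rw [Nat.mod_eq_of_lt (by omega), Nat.sub_add_cancel i.2.le, ← hK]
    have := Fintype.ofFinite K
    rw [Nat.card_eq_fintype_card, FiniteField.pow_card]

/-- L_f represents the polar form with respect to the trace pairing; the coefficients a_{m-i}^{p^i}
are those needed to shift the Frobenius power from x to z. -/
theorem Tr_mul_linPoly [Finite K] (hK : Nat.card K = p ^ m) (a : Fin m → K)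
    (x z : K) : Tr (p := p) (x * linPoly p a z) = polarForm p a x z := by
  have h1 : x * linPoly p a z
      = (2⁻¹ : ZMod p) • ∑ i : Fin m, (x * (a i * z ^ p ^ (i : ℕ))
          + x * (a (-i) * z) ^ p ^ (i : ℕ)) := by
    have h2 : ((2⁻¹ : ZMod p) • (1 : K)) = 2⁻¹ := by
      rw [← Algebra.algebraMap_eq_smul_one, map_inv₀, map_ofNat]
    rw [linPoly, ← h2, smul_mul_assoc, one_mul, mul_smul_comm, Finset.mul_sum]
    congr 1
    refine Finset.sum_congr rfl fun i _ => ?_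
    rw [mul_pow]; ring
  rw [h1, Tr_smul, polarForm_apply]
  congr 1
  have hsum : ∀ g : Fin m → K, Tr (p := p) (∑ i, g i) = ∑ i, Tr (p := p) (g i) :=
    fun g => map_sum (Algebra.trace (ZMod p) K) g _
  rw [hsum]
  simp_rw [mul_add, Tr_add]
  rw [Finset.sum_add_distrib, Finset.sum_add_distrib, add_comm]
  congr 1
  · rcases m with _ | m
    · simp
    -- Reindexing by i ↦ -i turns the twisted coefficients back into a_i and puts the Frobenius
    -- power on x.
    rw [← Equiv.sum_comp (Equiv.neg (Fin (m + 1)))]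
    refine Finset.sum_congr rfl fun i _ => ?_
    rw [Equiv.neg_apply, neg_neg, Tr_mul_pow_neg hK]
    congr 1; ring
  · refine Finset.sum_congr rfl fun i _ => ?_
    congr 1; ring

theorem exists_diagonalizing_equiv (a : Fin m → K) (v : Module.Basis (Fin m) (ZMod p) K)
    (M : GL (Fin m) (ZMod p)) (l : Fin m → ZMod p)
    (hM : (M : Matrix (Fin m) (Fin m) (ZMod p)) * quadMatrix a v
      * (M : Matrix (Fin m) (Fin m) (ZMod p)).transpose = Matrix.diagonal l) :
    ∃ T : (Fin m → ZMod p) ≃ₗ[ZMod p] K,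
      ∀ z w, polarForm p a (T z) (T w) = ∑ j, l j * (z j * w j) := by
  have h1 : (M : Matrix (Fin m) (Fin m) (ZMod p)).transpose
      * ((M⁻¹ : GL (Fin m) (ZMod p)) : Matrix (Fin m) (Fin m) (ZMod p)).transpose = 1 := by
    rw [← Matrix.transpose_mul, ← Units.val_mul, inv_mul_cancel, Units.val_one,
      Matrix.transpose_one]
  have h2 : ((M⁻¹ : GL (Fin m) (ZMod p)) : Matrix (Fin m) (Fin m) (ZMod p)).transpose
      * (M : Matrix (Fin m) (Fin m) (ZMod p)).transpose = 1 := by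
    rw [← Matrix.transpose_mul, ← Units.val_mul, mul_inv_cancel, Units.val_one,
      Matrix.transpose_one]
  refine ⟨(Matrix.toLin'OfInv h2 h1).trans v.equivFun.symm, fun z w => ?_⟩
  have h3 : ∀ z, ⇑(v.repr (((Matrix.toLin'OfInv h2 h1).trans v.equivFun.symm) z))
      = (M : Matrix (Fin m) (Fin m) (ZMod p)).transpose.mulVec z := by
    intro z
    rw [LinearEquiv.trans_apply, ← Module.Basis.equivFun_apply, LinearEquiv.apply_symm_apply]
    rfl
  rw [LinearMap.BilinForm.apply_eq_dotProduct_toMatrix_mulVec v, h3, h3, toMatrix_polarForm,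
    Matrix.mulVec_transpose, ← Matrix.dotProduct_mulVec, Matrix.mulVec_mulVec,
    Matrix.mulVec_mulVec, hM]
  simp only [dotProduct, Matrix.mulVec_diagonal]
  exact Finset.sum_congr rfl fun j _ => by ring

/-- By nondegeneracy of the trace form every functional on GF(q) is Tr(b ·) for a unique b, so b can
be replaced by its coefficient vector. -/
theorem exists_trace_coordinates [Finite K] (T : (Fin m → ZMod p) ≃ₗ[ZMod p] K) :
    ∃ φ : K ≃ₗ[ZMod p] (Fin m → ZMod p), ∀ b z, Tr (p := p) (b * T z) = ∑ j, φ b j * z j := by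
  let f : K →ₗ[ZMod p] (Fin m → ZMod p) := LinearMap.pi fun j =>
    (Algebra.traceForm (ZMod p) K).flip (T (Pi.single j 1))
  have hf : ∀ b z, Tr (p := p) (b * T z) = ∑ j, f b j * z j := by
    intro b z
    have hz : z = ∑ j, z j • (Pi.single j 1 : Fin m → ZMod p) := by
      ext i
      simp [Finset.sum_apply, Pi.single_apply]
    conv_lhs => rw [hz, map_sum, Finset.mul_sum]
    rw [show Tr (p := p) (∑ i, b * T (z i • (Pi.single i 1 : Fin m → ZMod p)))
      = ∑ i, Tr (p := p) (b * T (z i • (Pi.single i 1 : Fin m → ZMod p))) from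
      map_sum (Algebra.trace (ZMod p) K) _ _]
    refine Finset.sum_congr rfl fun j _ => ?_
    rw [map_smul, mul_smul_comm, Tr_smul, mul_comm]
    rfl
  have hinj : Function.Injective f := by
    rw [injective_iff_map_eq_zero]
    intro b hb
    refine (traceForm_nondegenerate (ZMod p) K).1 b fun x => ?_
    have := hf b (T.symm x)
    rw [LinearEquiv.apply_symm_apply, hb] at this
    simpa [Tr] using this
  exact ⟨LinearEquiv.ofInjectiveOfFinrankEq f hinj T.symm.finrank_eq, hf⟩

end Field

/-- From |pe| ≤ 1 follows p - 1 ≤ 2, so p = 3 and e = 1/3. The size of e forces r = 2, and p* = -3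
forces the sign -1. -/
theorem eq_three_of_degenerate {p : ℕ} [Fact p.Prime] (hp : p ≠ 2) {ι : Type*} [Fintype ι]
    [DecidableEq ι] (l u : ι → ZMod p) (hr : Even #{i | l i ≠ 0}) (hu : ∃ i, l i ≠ 0 ∧ u i ≠ 0)
    {ε : ℤ} (hε : formErr l = ε * (pStar p ^ (#{i | l i ≠ 0} / 2))⁻¹)
    (h : (p : ℚ) - 1 - 2 * formErr l * p = 0) :
    p = 3 ∧ #{i | l i ≠ 0} = 2 ∧ ε = -1 := by
  have h3 := three_le_cast hp
  have h1 := (abs_le.1 ((sq_le_one_iff_abs_le_one _).1 (mul_formErr_sq_le l u hr hu))).2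
  have hpq : (p : ℚ) = 3 := by linarith
  have hp3 : p = 3 := by exact_mod_cast hpq
  have h2 := formErr_sq_mul l
  have he : formErr l = 1 / 3 := by
    rw [hpq] at h; linarith
  have hps : pStar p = -3 := by rw [hp3]; norm_num [pStar]
  rw [he, hpq] at h2
  obtain ⟨k, hk⟩ := hr
  rw [hk, show (k + k) / 2 = k by omega] at h2 hε
  have hk1 : k = 1 := by
    have h4 : (3 : ℚ) ^ (2 * k) = 3 ^ 2 := by
      linarith
    have := pow_right_injective₀ (by norm_num : (0 : ℚ) < 3) (by norm_num) h4
    omega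
  refine ⟨hp3, by omega, ?_⟩
  rw [he, hk1, hps] at hε
  have : (ε : ℚ) = -1 := by linarith
  exact_mod_cast this

variable {p : ℕ} [Fact p.Prime] {K : Type*} [Field K] [Algebra (ZMod p) K] {m : ℕ}

/-- The substitution x = Tz - x_α translates D to the quadric through x_α; the excluded x = 0 is the
point x_α itself. -/
theorem card_filter_definingSet {a : Fin m → K} {α xα : K} {l : Fin m → ZMod p}
    {T : (Fin m → ZMod p) ≃ₗ[ZMod p] K} {n : ℕ} {d : Fin n → K} (hd : Function.Injective d)
    (hD : Set.range d = definingSet (p := p) a α)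
    (hT : ∀ z, quadFun (p := p) a (T z - xα) - Tr (p := p) (α * (T z - xα)) = 0 ↔
      ∑ i, l i * z i ^ 2 = ∑ i, l i * T.symm xα i ^ 2) (P : K → Prop) [DecidablePred P] :
    #{i | P (d i)} = #{z : Fin m → ZMod p | ∑ i, l i * z i ^ 2 = ∑ i, l i * T.symm xα i ^ 2
      ∧ z ≠ T.symm xα ∧ P (T z - xα)} := by
  have hmem : ∀ i, d i ≠ 0 ∧ quadFun (p := p) a (d i) - Tr (p := p) (α * d i) = 0 := fun i => by
    have : d i ∈ definingSet (p := p) a α := hD ▸ Set.mem_range_self i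
    exact this
  have hTd : ∀ i, T (T.symm (d i + xα)) - xα = d i := fun i => by
    rw [LinearEquiv.apply_symm_apply, add_sub_cancel_right]
  refine Finset.card_bij (fun i _ => T.symm (d i + xα)) ?_ ?_ ?_
  · intro i hi
    simp only [Finset.mem_filter, Finset.mem_univ, true_and] at hi ⊢
    refine ⟨?_, ?_, ?_⟩
    · rw [← hT, hTd]; exact (hmem i).2
    · intro h
      exact (hmem i).1 (by simpa using T.symm.injective h)
    · rwa [hTd]
  · intro i _ j _ h
    exact hd (add_right_cancel (T.symm.injective h))
  · intro z hz
    simp only [Finset.mem_filter, Finset.mem_univ, true_and] at hz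
    have : T z - xα ∈ Set.range d := by
      rw [hD]
      refine ⟨fun h => hz.2.1 ?_, (hT z).2 hz.1⟩
      rw [← sub_eq_zero.1 h, LinearEquiv.symm_apply_apply]
    obtain ⟨i, hi⟩ := this
    refine ⟨i, by simpa [hi] using hz.2.2, ?_⟩
    rw [hi, sub_add_cancel, LinearEquiv.symm_apply_apply]

/-- Only b = 0 has weight 0, so evaluation is injective: the dimension is m, and codewords of a
given weight correspond to vectors b. -/
theorem hasWeightDistribution_of_diag {l u : Fin m → ZMod p} {n : ℕ} {d : Fin n → K}
    (φ : K ≃ₗ[ZMod p] (Fin m → ZMod p))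
    (hφ : ∀ b, hammingNorm (fun i => Tr (p := p) (b * d i)) = diagWeight l u (φ b))
    {T : List (ℚ × ℚ)} (hT : HasDiagDistribution l u T) :
    Module.finrank (ZMod p) (traceCode (p := p) d) = m ∧
      HasWeightDistribution (traceCode (p := p) d) T := by
  obtain ⟨h0, hcard, hex⟩ := hT
  have hinj : Function.Injective (LinearMap.pi fun i =>
      (Algebra.trace (ZMod p) K).comp (LinearMap.mulRight (ZMod p) (d i))) := by
    rw [injective_iff_map_eq_zero]
    intro b hb
    have h1 : (fun i => Tr (p := p) (b * d i)) = 0 := hb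
    have h2 := hφ b
    rw [h1, hammingNorm_zero] at h2
    simpa using h0 _ h2.symm
  refine ⟨?_, fun t ht => ?_, fun c hc => ?_⟩
  · rw [traceCode, LinearMap.finrank_range_of_inj hinj, φ.finrank_eq, Module.finrank_fin_fun]
  · rw [← hcard t ht]
    have h1 : {c | c ∈ traceCode (p := p) d ∧ (hammingNorm c : ℚ) = t.1}
        = (fun b i => Tr (p := p) (φ.symm b * d i)) ''
          (({b | (diagWeight l u b : ℚ) = t.1} : Finset (Fin m → ZMod p)) : Set (Fin m → ZMod p)) := by
      ext c
      simp only [Set.mem_ofPred_eq, Set.mem_image, Finset.coe_filter, Finset.mem_univ, true_and,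
        mem_traceCode]
      constructor
      · rintro ⟨⟨x, rfl⟩, h⟩
        exact ⟨φ x, by rw [← hφ, h], by simp⟩
      · rintro ⟨b, hb, rfl⟩
        exact ⟨⟨_, rfl⟩, by rw [hφ, LinearEquiv.apply_symm_apply, hb]⟩
    rw [h1, Set.ncard_image_of_injective, Set.ncard_coe_finset]
    exact fun b b' h => φ.symm.injective (hinj h)
  · obtain ⟨x, rfl⟩ := (mem_traceCode d c).1 hc
    rw [hφ]
    exact hex _

end QuadCode

end

/-! ### Assembly of the length, dimension and weight distribution -/

theorem theorem1 {p : ℕ} [Fact p.Prime] (hp : p ≠ 2)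
    {K : Type*} [Field K] [Finite K] [Algebra (ZMod p) K] (m : ℕ) (hK : Nat.card K = p ^ m)
    (v : Module.Basis (Fin m) (ZMod p) K)
    (a : Fin m → K) (r : ℕ) (hr : (QuadCode.quadMatrix a v).rank = r)
    (ε : ℤ) (hε : QuadCode.IsSign (QuadCode.quadMatrix a v) ε)
    (α : K) (hα : α ≠ 0) (xα : K) (hxα : QuadCode.linPoly p a xα = -α / 2)
    (n : ℕ) (d : Fin n → K) (hd : Function.Injective d)
    (hD : Set.range d = QuadCode.definingSet (p := p) a α)
    (y : ZMod p) (hy : y = QuadCode.quadFun a xα) :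
    -- the length
    ((Even r → y ≠ 0 →
        (n : ℚ) = (p : ℚ) ^ (m - 1) * (1 - ε * (QuadCode.pStar p ^ (r / 2))⁻¹) - 1) ∧
      (Even r → y = 0 →
        (n : ℚ) = (p : ℚ) ^ (m - 1) * (1 + ε * (p - 1) * (QuadCode.pStar p ^ (r / 2))⁻¹) - 1) ∧
      (Odd r → y ≠ 0 →
        (n : ℚ) = (p : ℚ) ^ (m - 1) *
          (1 + ε * quadraticChar (ZMod p) (-y) * (QuadCode.pStar p ^ ((r - 1) / 2))⁻¹) - 1) ∧
      (Odd r → y = 0 → (n : ℚ) = (p : ℚ) ^ (m - 1) - 1)) ∧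
    -- dimension and weight distribution, outside the one degenerate case
    (¬ (p = 3 ∧ r = 2 ∧ ε = -1 ∧ y ≠ 0) →
      Module.finrank (ZMod p) (QuadCode.traceCode (p := p) d) = m ∧
      (Even r → y ≠ 0 → QuadCode.HasWeightDistribution (QuadCode.traceCode (p := p) d)
        (QuadCode.tableEvenNe p m r (ε * (QuadCode.pStar p ^ (r / 2))⁻¹))) ∧
      (Even r → y = 0 → QuadCode.HasWeightDistribution (QuadCode.traceCode (p := p) d)
        (QuadCode.tableEvenEq p m r (ε * (QuadCode.pStar p ^ (r / 2))⁻¹))) ∧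
      (Odd r → y ≠ 0 → QuadCode.HasWeightDistribution (QuadCode.traceCode (p := p) d)
        (QuadCode.tableOddNe p m r
          (ε * quadraticChar (ZMod p) (-y) * (QuadCode.pStar p ^ ((r - 1) / 2))⁻¹))) ∧
      (Odd r → y = 0 → QuadCode.HasWeightDistribution (QuadCode.traceCode (p := p) d)
        (QuadCode.tableOddEq p m r (ε * (QuadCode.pStar p ^ ((r - 1) / 2))⁻¹)))) := by
  classical
  have hchar := QuadCode.charP_of_algebra_zmod p K
  obtain ⟨M, l, hMl, hεl⟩ := hε
  have hrank : (Finset.univ.filter fun i => l i ≠ 0).card = r := by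
    have hM : IsUnit (M : Matrix (Fin m) (Fin m) (ZMod p)).det :=
      (Matrix.isUnit_iff_isUnit_det _).1 M.isUnit
    rw [← hr, ← Matrix.rank_mul_eq_right_of_isUnit_det _ (QuadCode.quadMatrix a v) hM,
      ← Matrix.rank_mul_eq_left_of_isUnit_det _ (M.1 * QuadCode.quadMatrix a v)
        (by rwa [Matrix.det_transpose] : IsUnit M.1.transpose.det), hMl, Matrix.rank_diagonal,
      Fintype.card_subtype]
  obtain ⟨T, hT⟩ := QuadCode.exists_diagonalizing_equiv a v M l hMl
  obtain ⟨φ, hφ⟩ := QuadCode.exists_trace_coordinates T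
  obtain ⟨u, hu⟩ : ∃ u, u = T.symm xα := ⟨_, rfl⟩
  have hTu : T u = xα := by rw [hu, LinearEquiv.apply_symm_apply]
  have htr : ∀ x, QuadCode.Tr (p := p) (α * x) = -2 * QuadCode.polarForm p a x xα := by
    intro x
    have h2 : (2 : K) ≠ 0 := by
      intro h
      apply QuadCode.two_ne_zero_zmod hp
      apply (algebraMap (ZMod p) K).injective
      rw [map_ofNat, map_zero, h]
    rw [← QuadCode.Tr_mul_linPoly hK, hxα, ← QuadCode.Tr_smul]
    congr 1
    rw [neg_smul, two_smul]
    field_simp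
    ring
  have hyu : ∑ i, l i * u i ^ 2 = y := by
    rw [hy, ← QuadCode.polarForm_self hp, ← hTu, hT]
    exact Finset.sum_congr rfl fun i _ => by ring
  -- Otherwise x_α lies in the radical, so Tr(αx) = -2B(x, x_α) vanishes for all x, contradicting α
  -- ≠ 0.
  have hu0 : ∃ i, l i ≠ 0 ∧ u i ≠ 0 := by
    by_contra h
    push Not at h
    apply hα
    refine (traceForm_nondegenerate (ZMod p) K).1 α fun x => ?_
    have h1 := htr x
    rw [← T.apply_symm_apply x, ← hTu, hT, Finset.sum_eq_zero, mul_zero] at h1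
    · simpa [QuadCode.Tr] using h1
    · intro i _
      by_cases hi : l i = 0
      · simp [hi]
      · simp [h i hi]
  have hquad : ∀ z, QuadCode.quadFun (p := p) a (T z - xα)
      - QuadCode.Tr (p := p) (α * (T z - xα)) = 0 ↔
      ∑ i, l i * z i ^ 2 = ∑ i, l i * T.symm xα i ^ 2 := by
    intro z
    rw [htr, ← QuadCode.polarForm_self hp, ← sub_eq_zero (b := ∑ i, l i * T.symm xα i ^ 2)]
    have h1 : ∑ i, l i * z i ^ 2 = QuadCode.polarForm p a (T z) (T z) := by
      rw [hT]; exact Finset.sum_congr rfl fun i _ => by ring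
    have h2 : ∑ i, l i * T.symm xα i ^ 2 = QuadCode.polarForm p a xα xα := by
      rw [← hTu, hT, LinearEquiv.symm_apply_apply]
      exact Finset.sum_congr rfl fun i _ => by ring
    rw [h1, h2]
    simp only [map_sub, LinearMap.sub_apply]
    rw [QuadCode.polarForm_comm a xα (T z)]
    ring_nf
  -- The extra 1 is the point u of the quadric, which corresponds to x = 0.
  have hlen : n + 1 = (Finset.univ.filter fun z : Fin m → ZMod p => ∑ i, l i * z i ^ 2 = y).card := by
    have h := QuadCode.card_filter_definingSet hd hD hquad fun _ => True
    rw [← hu, hyu] at h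
    simp only [Finset.filter_true, Finset.card_univ, Fintype.card_fin, and_true] at h
    rw [h, ← Finset.card_insert_of_notMem (a := u) (by simp)]
    congr 1
    ext z
    simp only [Finset.mem_insert, Finset.mem_filter, Finset.mem_univ, true_and]
    by_cases hz : z = u
    · simp [hz, hyu]
    · simp [hz]
  have hweight : ∀ b, hammingNorm (fun i => QuadCode.Tr (p := p) (b * d i))
      = QuadCode.diagWeight l u (φ b) := by
    intro b
    have h := QuadCode.card_filter_definingSet hd hD hquad
      fun x => QuadCode.Tr (p := p) (b * x) ≠ 0
    rw [hammingNorm, h, QuadCode.diagWeight, ← hu]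
    congr 1
    ext z
    simp only [Finset.mem_filter, Finset.mem_univ, true_and]
    have h1 : QuadCode.Tr (p := p) (b * (T z - xα)) = ∑ j, φ b j * z j - ∑ j, φ b j * u j := by
      rw [← hφ, ← hφ, hTu, mul_sub]
      exact map_sub (Algebra.trace (ZMod p) K) _ _
    rw [h1, sub_ne_zero]
    -- The condition z ≠ u is automatic here, because b·z ≠ b·u.
    refine and_congr_right fun _ => ⟨fun h => h.2, fun h => ⟨?_, h⟩⟩
    rintro rfl
    exact h rfl
  have herr : QuadCode.formErr l = ε * (QuadCode.pStar p ^ (r / 2))⁻¹ := by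
    rw [QuadCode.formErr, hεl, hr, hrank]
  have hodd : Odd r → (r - 1) / 2 = r / 2 := by
    rintro ⟨k, rfl⟩; omega
  have hlenQ : (n : ℚ)
      = (Finset.univ.filter fun z : Fin m → ZMod p => ∑ i, l i * z i ^ 2 = y).card - 1 := by
    rw [← hlen]; push_cast; ring
  -- The truncated exponent m - 1 is the true difference because a coordinate exists, so m ≥ 1.
  have hm : (p : ℚ) ^ ((Fintype.card (Fin m) : ℤ) - 1) = (p : ℚ) ^ (m - 1) := by
    have hm0 : 1 ≤ m := by
      obtain ⟨i, -⟩ := hu0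
      have := i.2
      omega
    rw [Fintype.card_fin, ← zpow_natCast, Nat.cast_sub hm0, Nat.cast_one]
  have hEven : Even r → Even (Finset.univ.filter fun i => l i ≠ 0).card := fun h => by rwa [hrank]
  have hOdd : Odd r → Odd (Finset.univ.filter fun i => l i ≠ 0).card := fun h => by rwa [hrank]
  have evenNe : Even r → y ≠ 0 → ¬ (p = 3 ∧ r = 2 ∧ ε = -1 ∧ y ≠ 0) → _ := fun h1 h2 h3 =>
    QuadCode.hasWeightDistribution_of_diag φ hweight
      (QuadCode.hasDiagDistribution_evenNe hp l u (hEven h1) hu0 (by rwa [hyu]) fun h => by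
        obtain ⟨h4, h5, h6⟩ := QuadCode.eq_three_of_degenerate hp l u (hEven h1) hu0
          (by rw [hrank]; exact herr) h
        exact h3 ⟨h4, by rw [← hrank, h5], h6, h2⟩)
  have evenEq : Even r → y = 0 → _ := fun h1 h2 =>
    QuadCode.hasWeightDistribution_of_diag φ hweight
      (QuadCode.hasDiagDistribution_evenEq hp l u (hEven h1) hu0 (by rwa [hyu]))
  have oddNe : Odd r → y ≠ 0 → _ := fun h1 h2 =>
    QuadCode.hasWeightDistribution_of_diag φ hweight
      (QuadCode.hasDiagDistribution_oddNe hp l u (hOdd h1) hu0 hyu h2)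
  have oddEq : Odd r → y = 0 → _ := fun h1 h2 =>
    QuadCode.hasWeightDistribution_of_diag φ hweight
      (QuadCode.hasDiagDistribution_oddEq hp l u (hOdd h1) hu0 (by rwa [hyu]))
  rw [hrank, Fintype.card_fin, herr] at evenNe evenEq oddNe oddEq
  refine ⟨⟨fun h1 h2 => ?_, fun h1 h2 => ?_, fun h1 h2 => ?_, fun h1 h2 => ?_⟩,
    fun hexc => ⟨?_, fun h1 h2 => (evenNe h1 h2 hexc).2, fun h1 h2 => (evenEq h1 h2).2,
      fun h1 h2 => ?_, fun h1 h2 => ?_⟩⟩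
  · rw [hlenQ, QuadCode.card_quadric_even hp l (hEven h1), hm, herr, if_neg h2]
    ring
  · rw [hlenQ, QuadCode.card_quadric_even hp l (hEven h1), hm, herr, if_pos h2]
    ring
  · rw [hlenQ, QuadCode.card_quadric_odd hp l (hOdd h1), hm, herr, hodd h1]
    ring
  · rw [hlenQ, QuadCode.card_quadric_odd hp l (hOdd h1), hm, h2, neg_zero, quadraticChar_zero]
    push_cast
    ring
  · rcases Nat.even_or_odd r with h1 | h1 <;> by_cases h2 : y = 0
    · exact (evenEq h1 h2).1
    · exact (evenNe h1 h2 hexc).1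
    · exact (oddEq h1 h2).1
    · exact (oddNe h1 h2).1
  · rw [hodd h1, mul_right_comm]
    exact (oddNe h1 h2).2
  · rw [hodd h1]
    exact (oddEq h1 h2).2
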